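/- Let $q$ be a complex number with $0<|q|<1$, let $\omega$ be a primitive cubic root of unity, and let $a\in\mathbb C$. Write $(a;q)_n=\prod_{j=0}^{n-1}(1-aq^j)$ for $0\le n\le\infty$, $(a_1,\dots,a_m;q)_n=(a_1;q)_n\cdots(a_m;q)_n$, and $${}_r\phi_s\left(\begin{matrix}a_1,\dots,a_r\\b_1,\dots,b_s\end{matrix};q,z\right)=\sum_{n=0}^\infty\frac{(a_1,\dots,a_r;q)_n}{(q,b_1,\dots,b_s;q)_n}\left((-1)^nq^{\binom n2}\right)^{1+s-r}z^n .$$ Each of the following four transformation formulas holds whenever all the series in it are well defined (no vanishing denominators in the terms) and converge and, in (3) and (4), the infinite product in the denominator of the right-hand side does not vanish (that is, $(a^4q^{-2};q)_\infty\ne0$ in (3) and $(a^4q^{-3};q)_\infty\neq 0$ in (4)): $$\text{(1)}\quad {}_2\phi_1\left(\begin{matrix}a\omega,-a\omega\\-a^2\end{matrix};q,a^2q^{-1}\omega^2\right)=\frac{(a^6;q^2)_\infty(a^6q^{-3};q^6)_\infty}{(a^2q^{-1}\omega^2,a^4q^{-1};q)_\infty}\,{}_3\phi_2\left(\begin{matrix}a^2q,a^2q^3,a^2q^5\\a^6q^2,a^6q^4\end{matrix};q^6,a^6q^{-3}\right),$$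 $$\text{(2)}\quad {}_2\phi_1\left(\begin{matrix}a\omega,aq\omega\\a^2q\end{matrix};q^2,a^2\omega^2\right)=\frac{(a^3;q)_\infty(-a^3;q^3)_\infty}{(a^2\omega^2,a^4;q^2)_\infty}\,{}_3\phi_2\left(\begin{matrix}-a,-aq,-aq^2\\a^3q,a^3q^2\end{matrix};q^3,-a^3\right),$$ $$\text{(3)}\quad {}_2\phi_2\left(\begin{matrix}a^2q^{-1}\omega,a^2q^{-1}\omega^2\\a^3q^{-1},-a^3q^{-1}\end{matrix};q,-a^2q^{-1}\right)=\frac{(-a^2q^{-1};q)_\infty(a^6q^{-3};q^6)_\infty}{(a^4q^{-2};q)_\infty}\,{}_3\phi_2\left(\begin{matrix}a^2q^{-1},a^2q,a^2q^3\\a^6q^{-2},a^6q^2\end{matrix};q^6,a^6q^{-3}\right),$$ $$\text{(4)}\quad {}_2\phi_2\left(\begin{matrix}a^2q^{-3}\omega,a^2q^{-3}\omega^2\\a^3q^{-3},-a^3q^{-3}\end{matrix};q,-a^2q^{-1}\right)=\frac{(-a^2q^{-1};q)_\infty(a^6q^{-9};q^6)_\infty}{(1-a^2q^{-3})(1-a^6q^{-6})(a^4q^{-3};q)_\infty}$$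 $$\times\left({}_3\phi_2\left(\begin{matrix}a^2q^{-1},a^2q,a^2q^3\\a^6q^{-4},a^6q^{-2}\end{matrix};q^6,a^6q^{-9}\right)-a^2q^{-3}\,\frac{1-a^2q^{-1}}{1-a^6q^{-4}}\,{}_3\phi_2\left(\begin{matrix}a^2q,a^2q^3,a^2q^5\\a^6q^{-2},a^6q^2\end{matrix};q^6,a^6q^{-9}\right)\right).$$ -/

import Mathlib

open Filter Topology

noncomputable section

/-- The finite `q`-shifted factorial `(a;q)_n = ∏_{j<n} (1 - a q^j)`. -/
def qPoch (a q : ℂ) (n : ℕ) : ℂ :=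
  ∏ j ∈ Finset.range n, (1 - a * q ^ j)

/-- The infinite `q`-shifted factorial `(a;q)_∞ = ∏_{j≥0} (1 - a q^j)` (used for `|q| < 1`). -/
def qPochInf (a q : ℂ) : ℂ :=
  ∏' j : ℕ, (1 - a * q ^ j)

/-- The `n`-th term of the basic hypergeometric series `_rφ_s`, with upper parameters `as`
(so `r = as.length`) and lower parameters `bs` (so `s = bs.length`):
`(a₁,…,a_r;q)_n / (q,b₁,…,b_s;q)_n * ((-1)^n q^(n choose 2))^(1+s-r) * z^n`. -/
def phiTerm (as bs : List ℂ) (q z : ℂ) (n : ℕ) : ℂ :=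
  (as.map fun a => qPoch a q n).prod / (qPoch q q n * (bs.map fun b => qPoch b q n).prod)
    * ((-1) ^ n * q ^ n.choose 2) ^ (1 + (bs.length : ℤ) - (as.length : ℤ)) * z ^ n

/-- The series `_rφ_s` is well defined (no lower parameter produces a zero denominator) and
its partial sums converge. -/
def PhiConverges (as bs : List ℂ) (q z : ℂ) : Prop :=
  (∀ b ∈ bs, ∀ n : ℕ, qPoch b q n ≠ 0) ∧
    ∃ s : ℂ, Tendsto (fun N : ℕ => ∑ n ∈ Finset.range N, phiTerm as bs q z n) atTop (𝓝 s)

/-- The sum of the basic hypergeometric series `_rφ_s`. -/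
def phi (as bs : List ℂ) (q z : ℂ) : ℂ :=
  ∑' n : ℕ, phiTerm as bs q z n

end

set_option maxHeartbeats 2000000

/-! ### Shifted factorials: dissections, limits and bounds. -/

section Basic

variable {a q z : ℂ}

/-! Each formula comes from evaluating one sum in two ways. The sum is `rogersSum`: a q-binomial
series in base p whose m-th term is weighted by the Rogers generating function R(m) = (βBp^m, βCp^m;
p)_∞ / (Bp^m, Cp^m; p)_∞.

Cubic side. Let B = Aω and C = Aω². Since (x, xω, xω²; p)_∞ = (x³; p³)_∞, the weight R(m) is, up to
a constant, (βA; p)_m / (A; p)_m times a quotient of products in base p³ (`rogersRatio_cubic`). If A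
is also the q-binomial parameter, (A; p)_m cancels, and the bibasic Heine transformation
`tsum_bibasic_heine` yields a ₃φ₂ in base p³ (`rogersSum_cubic`). If the parameter is Ap instead, a
factor 1 - Ap^m survives and splits the sum, whence the two ₃φ₂ of the fourth formula
(`rogersSum_cubic_shifted`).

Quadratic side. Replace B, C by Bp^k, Cp^k. When β² = Az the sum satisfies a second order
q-difference equation in x = p^k (`rogersEquation_rogersSum`), whose solutions of controlled growth
are determined by their limit as k → ∞ (`rogersEquation_unique`). The ₂φ₁ of the first two formulas,
times explicit products, solve the same equation: `rogersSum_eq_sign` (p = q², z = Aq², β = Aq) and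
`rogersSum_eq_quadratic` (p = q, z = A, β = -A). For the ₂φ₂ one has p = q² and β = q times the
q-binomial parameter and argument, which coincide; the moments j = 0, 1 then form a first order
system, and it is the moment j = 1 that satisfies the equation (`tsum_entireTerm_eq_rogersSum`).

All this needs |A| < 1, where A is a²/q, -a, a²/q, a²/q³ in the four formulas. If |A| ≥ 1,
convergence forces a numerator parameter to be an inverse power of the base
(`exists_mul_pow_eq_one_of_phiConverges`). In the first two formulas the conditions from the two
sides contradict each other; in the last two the product assumed nonzero would vanish. -/

theorem qPoch_zero (a q : ℂ) : qPoch a q 0 = 1 := by simp [qPoch]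

theorem qPoch_succ (a q : ℂ) (n : ℕ) : qPoch a q (n + 1) = qPoch a q n * (1 - a * q ^ n) := by
  simp [qPoch, Finset.prod_range_succ]

theorem qPoch_succ' (a q : ℂ) (n : ℕ) : qPoch a q (n + 1) = (1 - a) * qPoch (a * q) q n := by
  simp only [qPoch, Finset.prod_range_succ', pow_succ', mul_assoc]
  simp [mul_comm]

theorem qPoch_zero_left (q : ℂ) (n : ℕ) : qPoch 0 q n = 1 := by simp [qPoch]

theorem qPoch_neg_mul (a q : ℂ) (n : ℕ) :
    qPoch a q n * qPoch (-a) q n = qPoch (a ^ 2) (q ^ 2) n := by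
  simp only [qPoch, ← Finset.prod_mul_distrib]
  refine Finset.prod_congr rfl fun j _ => ?_
  ring

theorem qPoch_two_mul (a q : ℂ) (n : ℕ) :
    qPoch a q (2 * n) = qPoch a (q ^ 2) n * qPoch (a * q) (q ^ 2) n := by
  induction n with
  | zero => simp [qPoch_zero]
  | succ n ih =>
    rw [show 2 * (n + 1) = 2 * n + 1 + 1 by ring, qPoch_succ, qPoch_succ, ih, qPoch_succ,
      qPoch_succ]
    ring

theorem qPoch_three_mul (a q : ℂ) (n : ℕ) :
    qPoch a q (3 * n) =
      qPoch a (q ^ 3) n * qPoch (a * q) (q ^ 3) n * qPoch (a * q ^ 2) (q ^ 3) n := by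
  induction n with
  | zero => simp [qPoch_zero]
  | succ n ih =>
    rw [show 3 * (n + 1) = 3 * n + 1 + 1 + 1 by ring, qPoch_succ, qPoch_succ, qPoch_succ, ih,
      qPoch_succ, qPoch_succ, qPoch_succ]
    ring

theorem one_sub_ne_zero_of_norm_lt_one (h : ‖z‖ < 1) : 1 - z ≠ 0 := by
  intro h0
  rw [← sub_eq_zero.mp h0] at h
  simp at h

theorem norm_mul_pow_lt_one (ha : ‖a‖ < 1) (hq : ‖q‖ < 1) (n : ℕ) : ‖a * q ^ n‖ < 1 := by
  rw [norm_mul, norm_pow]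
  exact (mul_le_of_le_one_right (norm_nonneg _) (pow_le_one₀ (norm_nonneg _) hq.le)).trans_lt ha

theorem qPoch_ne_zero (ha : ‖a‖ < 1) (hq : ‖q‖ < 1) (n : ℕ) : qPoch a q n ≠ 0 :=
  Finset.prod_ne_zero_iff.mpr fun _ _ =>
    one_sub_ne_zero_of_norm_lt_one (norm_mul_pow_lt_one ha hq _)

theorem summable_norm_mul_pow (a : ℂ) (hq : ‖q‖ < 1) : Summable fun j : ℕ => ‖-(a * q ^ j)‖ := by
  simp only [norm_neg, norm_mul, norm_pow]
  exact (summable_geometric_of_lt_one (norm_nonneg _) hq).mul_left _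

theorem multipliable_qPochInf (a : ℂ) (hq : ‖q‖ < 1) :
    Multipliable fun j : ℕ => (1 - a * q ^ j) := by
  simpa only [sub_eq_add_neg] using multipliable_one_add_of_summable (summable_norm_mul_pow a hq)

theorem tendsto_qPoch (a : ℂ) (hq : ‖q‖ < 1) :
    Tendsto (qPoch a q) atTop (𝓝 (qPochInf a q)) :=
  (multipliable_qPochInf a hq).tendsto_prod_tprod_nat

theorem qPochInf_eq_qPoch_mul (a : ℂ) (hq : ‖q‖ < 1) (n : ℕ) :
    qPochInf a q = qPoch a q n * qPochInf (a * q ^ n) q := by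
  have h : (fun j : ℕ => 1 - a * q ^ n * q ^ j) = fun j : ℕ => (1 - a * q ^ (j + n)) := by
    funext j; ring
  have := Multipliable.prod_mul_tprod_nat_mul' (f := fun j : ℕ => (1 - a * q ^ j)) (k := n)
    (by simpa only [h] using multipliable_qPochInf (a * q ^ n) hq)
  rw [qPochInf, qPochInf, h, ← this, qPoch]

theorem qPochInf_eq_mul (a : ℂ) (hq : ‖q‖ < 1) :
    qPochInf a q = (1 - a) * qPochInf (a * q) q := by
  simpa [qPoch] using qPochInf_eq_qPoch_mul a hq 1

theorem qPochInf_ne_zero (hq : ‖q‖ < 1) (h : ∀ j : ℕ, 1 - a * q ^ j ≠ 0) : qPochInf a q ≠ 0 := by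
  simpa only [qPochInf, sub_eq_add_neg] using
    tprod_one_add_ne_zero_of_summable (fun j => by simpa only [sub_eq_add_neg] using h j)
      (summable_norm_mul_pow a hq)

theorem qPochInf_ne_zero_of_norm_lt_one (ha : ‖a‖ < 1) (hq : ‖q‖ < 1) : qPochInf a q ≠ 0 :=
  qPochInf_ne_zero hq fun _ => one_sub_ne_zero_of_norm_lt_one (norm_mul_pow_lt_one ha hq _)

theorem qPochInf_eq_zero (hq : ‖q‖ < 1) {n : ℕ} (h : a * q ^ n = 1) : qPochInf a q = 0 := by
  rw [qPochInf_eq_qPoch_mul a hq n, qPochInf_eq_mul _ hq, h]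
  simp

/-- The bound is uniform in n, so it passes to the infinite product, where it gives continuity at 0
and rates of convergence. -/
theorem norm_qPoch_sub_one_le (a : ℂ) (hq : ‖q‖ < 1) (n : ℕ) :
    ‖qPoch a q n - 1‖ ≤ Real.exp (‖a‖ / (1 - ‖q‖)) - 1 := by
  have h := (Finset.range n).norm_prod_one_add_sub_one_le fun j : ℕ => -(a * q ^ j)
  simp only [← sub_eq_add_neg] at h
  refine h.trans (sub_le_sub_right (Real.exp_le_exp.mpr ?_) 1)
  simp only [norm_neg, norm_mul, norm_pow]
  rw [← Finset.mul_sum, div_eq_mul_inv, ← tsum_geometric_of_lt_one (norm_nonneg _) hq]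
  exact mul_le_mul_of_nonneg_left
    ((summable_geometric_of_lt_one (norm_nonneg _) hq).sum_le_tsum _
      fun _ _ => pow_nonneg (norm_nonneg _) _) (norm_nonneg _)

theorem norm_qPochInf_sub_one_le (a : ℂ) (hq : ‖q‖ < 1) :
    ‖qPochInf a q - 1‖ ≤ Real.exp (‖a‖ / (1 - ‖q‖)) - 1 :=
  le_of_tendsto ((tendsto_qPoch a hq).sub_const 1).norm
    (Eventually.of_forall (norm_qPoch_sub_one_le a hq))

theorem norm_qPoch_le (hq : ‖q‖ < 1) {s : ℝ} (ha : ‖a‖ ≤ s) (n : ℕ) :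
    ‖qPoch a q n‖ ≤ Real.exp (s / (1 - ‖q‖)) := by
  have h1 := norm_qPoch_sub_one_le a hq n
  have h2 := norm_le_norm_sub_add (qPoch a q n) 1
  have h3 : Real.exp (‖a‖ / (1 - ‖q‖)) ≤ Real.exp (s / (1 - ‖q‖)) :=
    Real.exp_le_exp.mpr (div_le_div_of_nonneg_right ha (sub_nonneg.mpr hq.le))
  simp only [norm_one] at h2
  linarith

theorem norm_qPochInf_le (hq : ‖q‖ < 1) {s : ℝ} (ha : ‖a‖ ≤ s) :
    ‖qPochInf a q‖ ≤ Real.exp (s / (1 - ‖q‖)) :=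
  le_of_tendsto (tendsto_qPoch a hq).norm (Eventually.of_forall (norm_qPoch_le hq ha))

theorem tendsto_qPochInf_nhds_zero (hq : ‖q‖ < 1) :
    Tendsto (fun x => qPochInf x q) (𝓝 0) (𝓝 1) := by
  rw [tendsto_iff_norm_sub_tendsto_zero]
  refine squeeze_zero (fun _ => norm_nonneg _) (fun x => norm_qPochInf_sub_one_le x hq) ?_
  have : Continuous fun x : ℂ => Real.exp (‖x‖ / (1 - ‖q‖)) - 1 := by fun_prop
  simpa using this.tendsto 0

theorem tendsto_mul_pow (a : ℂ) (hq : ‖q‖ < 1) :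
    Tendsto (fun n : ℕ => a * q ^ n) atTop (𝓝 0) := by
  simpa using (tendsto_pow_atTop_nhds_zero_of_norm_lt_one hq).const_mul a

theorem tendsto_qPochInf_mul_pow (a : ℂ) (hq : ‖q‖ < 1) :
    Tendsto (fun n : ℕ => qPochInf (a * q ^ n) q) atTop (𝓝 1) :=
  (tendsto_qPochInf_nhds_zero hq).comp (tendsto_mul_pow a hq)

theorem qPochInf_neg_mul (a : ℂ) (hq : ‖q‖ < 1) :
    qPochInf a q * qPochInf (-a) q = qPochInf (a ^ 2) (q ^ 2) := by
  have hq2 : ‖q ^ 2‖ < 1 := by rw [norm_pow]; exact pow_lt_one₀ (norm_nonneg _) hq two_ne_zero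
  refine tendsto_nhds_unique ((tendsto_qPoch a hq).mul (tendsto_qPoch (-a) hq)) ?_
  simpa only [qPoch_neg_mul] using tendsto_qPoch (a ^ 2) hq2

theorem qPochInf_eq_even_mul_odd (a : ℂ) (hq : ‖q‖ < 1) :
    qPochInf a q = qPochInf a (q ^ 2) * qPochInf (a * q) (q ^ 2) := by
  have hq2 : ‖q ^ 2‖ < 1 := by rw [norm_pow]; exact pow_lt_one₀ (norm_nonneg _) hq two_ne_zero
  refine tendsto_nhds_unique
    ((tendsto_qPoch a hq).comp (tendsto_id.const_mul_atTop' two_pos)) ?_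
  simpa only [Function.comp_def, id, qPoch_two_mul] using
    (tendsto_qPoch a hq2).mul (tendsto_qPoch (a * q) hq2)

theorem one_sub_mul_one_sub_mul_one_sub {ω : ℂ} (hω : IsPrimitiveRoot ω 3) (x : ℂ) :
    (1 - x) * (1 - x * ω) * (1 - x * ω ^ 2) = 1 - x ^ 3 := by
  have h3 : ω ^ 3 = 1 := hω.pow_eq_one
  have h1 : 1 + ω + ω ^ 2 = 0 := by
    have := hω.geom_sum_eq_zero (by norm_num)
    simpa [Finset.sum_range_succ] using this
  linear_combination (x ^ 2 * ω - x) * h1 - x ^ 3 * h3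

theorem qPoch_cubic {ω : ℂ} (hω : IsPrimitiveRoot ω 3) (a q : ℂ) (n : ℕ) :
    qPoch a q n * qPoch (a * ω) q n * qPoch (a * ω ^ 2) q n = qPoch (a ^ 3) (q ^ 3) n := by
  simp only [qPoch, ← Finset.prod_mul_distrib]
  refine Finset.prod_congr rfl fun j _ => ?_
  have := one_sub_mul_one_sub_mul_one_sub hω (a * q ^ j)
  linear_combination this

theorem qPochInf_cubic {ω : ℂ} (hω : IsPrimitiveRoot ω 3) (a : ℂ) (hq : ‖q‖ < 1) :
    qPochInf a q * qPochInf (a * ω) q * qPochInf (a * ω ^ 2) q = qPochInf (a ^ 3) (q ^ 3) := by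
  have hq3 : ‖q ^ 3‖ < 1 := by rw [norm_pow]; exact pow_lt_one₀ (norm_nonneg _) hq three_ne_zero
  refine tendsto_nhds_unique (((tendsto_qPoch a hq).mul (tendsto_qPoch (a * ω) hq)).mul
    (tendsto_qPoch (a * ω ^ 2) hq)) ?_
  simpa only [qPoch_cubic hω] using tendsto_qPoch (a ^ 3) hq3

end Basic

/-- The `n`-th term `(a;q)_n / (q;q)_n z^n` of the `q`-binomial series. -/
noncomputable def qBinomTerm (a q z : ℂ) (n : ℕ) : ℂ := qPoch a q n / qPoch q q n * z ^ n

/-! ### The q-binomial theorem and a bibasic Heine transformation. -/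

section QBinomial

variable {a q z : ℂ}

theorem summable_norm_of_succ_eq_mul {f c : ℕ → ℂ} {l : ℂ} (h : ∀ n, f (n + 1) = f n * c n)
    (hc : Tendsto c atTop (𝓝 l)) (hl : ‖l‖ < 1) : Summable fun n => ‖f n‖ := by
  obtain ⟨r, hlr, hr⟩ := exists_between hl
  refine summable_of_ratio_norm_eventually_le hr ?_
  filter_upwards [hc.norm.eventually_le_const hlr] with n hn
  rw [norm_norm, norm_norm, h, norm_mul, mul_comm]
  exact mul_le_mul_of_nonneg_right hn (norm_nonneg _)

theorem summable_norm_mul_of_bounded {u v : ℕ → ℂ} (hu : Summable fun n => ‖u n‖) {D : ℝ}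
    (hv : ∀ n, ‖v n‖ ≤ D) : Summable fun n => ‖u n * v n‖ := by
  refine Summable.of_nonneg_of_le (fun _ => norm_nonneg _) (fun n => ?_) (hu.mul_right D)
  rw [norm_mul]
  exact mul_le_mul_of_nonneg_left (hv n) (norm_nonneg _)

theorem norm_pow_le_one (hq : ‖q‖ < 1) (n : ℕ) : ‖q ^ n‖ ≤ 1 := by
  rw [norm_pow]; exact pow_le_one₀ (norm_nonneg _) hq.le

theorem summable_norm_mul_pow_pow {u : ℕ → ℂ} (hu : Summable fun n => ‖u n‖) (hq : ‖q‖ < 1)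
    (k : ℕ) : Summable fun n => ‖u n * (q ^ n) ^ k‖ :=
  summable_norm_mul_of_bounded hu (D := 1) fun n => by
    rw [← pow_mul]; exact norm_pow_le_one hq _

theorem norm_tsum_mul_pow_pow_sub_le {u : ℕ → ℂ} (hu : Summable fun n => ‖u n‖) (hq : ‖q‖ < 1)
    (k : ℕ) : ‖∑' n, u n * (q ^ n) ^ k - u 0‖ ≤ (∑' n, ‖u (n + 1)‖) * ‖q‖ ^ k := by
  have hs := summable_norm_mul_pow_pow hu hq k
  have hu' : Summable fun n => ‖u (n + 1)‖ := (summable_nat_add_iff 1).mpr hu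
  rw [hs.of_norm.tsum_eq_zero_add]
  simp only [pow_zero, one_pow, mul_one, add_sub_cancel_left]
  rw [← tsum_mul_right]
  refine tsum_of_norm_bounded (hu'.mul_right _).hasSum fun n => ?_
  rw [norm_mul, norm_pow, norm_pow, ← pow_mul]
  refine mul_le_mul_of_nonneg_left ?_ (norm_nonneg _)
  exact pow_le_pow_of_le_one (norm_nonneg _) hq.le (by nlinarith)

theorem tendsto_tsum_mul_pow_pow {u : ℕ → ℂ} (hu : Summable fun n => ‖u n‖) (hq : ‖q‖ < 1) :
    Tendsto (fun k => ∑' n, u n * (q ^ n) ^ k) atTop (𝓝 (u 0)) := by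
  rw [tendsto_iff_norm_sub_tendsto_zero]
  refine squeeze_zero (fun _ => norm_nonneg _) (norm_tsum_mul_pow_pow_sub_le hu hq) ?_
  simpa using (tendsto_pow_atTop_nhds_zero_of_lt_one (norm_nonneg _) hq).const_mul
    (∑' n, ‖u (n + 1)‖)

theorem one_sub_pow_succ_ne_zero (hq : ‖q‖ < 1) (n : ℕ) : 1 - q ^ (n + 1) ≠ 0 := by
  rw [pow_succ']; exact one_sub_ne_zero_of_norm_lt_one (norm_mul_pow_lt_one hq hq n)

theorem qPoch_self_succ (q : ℂ) (n : ℕ) :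
    qPoch q q (n + 1) = qPoch q q n * (1 - q ^ (n + 1)) := by
  rw [qPoch_succ, pow_succ']

theorem qBinomTerm_zero (a q z : ℂ) : qBinomTerm a q z 0 = 1 := by simp [qBinomTerm, qPoch_zero]

theorem qBinomTerm_succ (hq : ‖q‖ < 1) (a z : ℂ) (n : ℕ) :
    qBinomTerm a q z (n + 1) * (1 - q ^ (n + 1)) = qBinomTerm a q z n * ((1 - a * q ^ n) * z) := by
  have h1 := one_sub_pow_succ_ne_zero hq n
  have h2 := qPoch_ne_zero hq hq n
  simp only [qBinomTerm, qPoch_self_succ, qPoch_succ a]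
  field_simp
  ring

theorem qBinomTerm_mul_pow (a q z x : ℂ) (n k : ℕ) :
    qBinomTerm a q (z * x ^ k) n = qBinomTerm a q z n * (x ^ n) ^ k := by
  simp only [qBinomTerm, mul_pow]
  rw [← pow_mul, ← pow_mul, mul_comm k n]
  ring

theorem summable_norm_qBinomTerm (hq : ‖q‖ < 1) (hz : ‖z‖ < 1) (a : ℂ) :
    Summable fun n => ‖qBinomTerm a q z n‖ := by
  refine summable_norm_of_succ_eq_mul (c := fun n => (1 - a * q ^ n) * z / (1 - q * q ^ n))
    (l := z) (fun n => ?_) ?_ hz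
  · rw [← mul_div_assoc, ← pow_succ', eq_div_iff (one_sub_pow_succ_ne_zero hq n),
      qBinomTerm_succ hq]
  · have h := ((tendsto_mul_pow a hq).const_sub 1).mul_const z
    have h' : Tendsto (fun n : ℕ => (1 - a * q ^ n) * z / (1 - q * q ^ n)) atTop
        (𝓝 ((1 - 0) * z / (1 - 0))) := h.div ((tendsto_mul_pow q hq).const_sub 1) (by simp)
    simpa using h'

/-- Index shift: with u the q-binomial terms, Σ (1 - q^n) u_n r_n has no term at n = 0, and (1 -
q^(n+1)) u_(n+1) = (1 - aq^n) z u_n rewrites the rest. Constant r gives the functional equation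
behind the q-binomial theorem; Rogers ratios give `rogersSum_weight`. -/
theorem tsum_qBinomTerm_mul_one_sub_pow (hq : ‖q‖ < 1) (hz : ‖z‖ < 1) (a : ℂ) {r : ℕ → ℂ} {D : ℝ}
    (hr : ∀ n, ‖r n‖ ≤ D) :
    ∑' n, qBinomTerm a q z n * q ^ n * (r n - a * z * r (n + 1)) =
      ∑' n, qBinomTerm a q z n * (r n - z * r (n + 1)) := by
  have hu := summable_norm_qBinomTerm hq hz a
  have h0 : Summable fun n => qBinomTerm a q z n * r n :=
    (summable_norm_mul_of_bounded hu hr).of_norm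
  have h1 : Summable fun n => qBinomTerm a q z n * r (n + 1) :=
    (summable_norm_mul_of_bounded hu fun n => hr (n + 1)).of_norm
  have hu' : Summable fun n => ‖qBinomTerm a q z n * q ^ n‖ :=
    summable_norm_mul_of_bounded hu fun n => norm_pow_le_one hq n
  have h2 : Summable fun n => qBinomTerm a q z n * q ^ n * r n :=
    (summable_norm_mul_of_bounded hu' hr).of_norm
  have h3 : Summable fun n => qBinomTerm a q z n * q ^ n * r (n + 1) :=
    (summable_norm_mul_of_bounded hu' fun n => hr (n + 1)).of_norm
  have key : ∑' n, (qBinomTerm a q z n * r n - qBinomTerm a q z n * q ^ n * r n) =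
      ∑' n, (z * (qBinomTerm a q z n * r (n + 1)) -
        a * z * (qBinomTerm a q z n * q ^ n * r (n + 1))) := by
    rw [(h0.sub h2).tsum_eq_zero_add]
    simp only [pow_zero, mul_one, sub_self, zero_add]
    refine tsum_congr fun n => ?_
    linear_combination r (n + 1) * qBinomTerm_succ hq a z n
  rw [h0.tsum_sub h2, (h1.mul_left _).tsum_sub (h3.mul_left _)] at key
  have e1 : ∑' n, qBinomTerm a q z n * q ^ n * (r n - a * z * r (n + 1)) =
      ∑' n, (qBinomTerm a q z n * q ^ n * r n - a * z * (qBinomTerm a q z n * q ^ n * r (n + 1))) :=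
    tsum_congr fun n => by ring
  have e2 : ∑' n, qBinomTerm a q z n * (r n - z * r (n + 1)) =
      ∑' n, (qBinomTerm a q z n * r n - z * (qBinomTerm a q z n * r (n + 1))) :=
    tsum_congr fun n => by ring
  rw [e1, e2, h2.tsum_sub (h3.mul_left _), h0.tsum_sub (h1.mul_left _)]
  linear_combination -key

/-- The `q`-binomial theorem. -/
theorem tsum_qBinomTerm (hq : ‖q‖ < 1) (hz : ‖z‖ < 1) (a : ℂ) :
    ∑' n, qBinomTerm a q z n = qPochInf (a * z) q / qPochInf z q := by
  have hu := summable_norm_qBinomTerm hq hz a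
  -- The functional equation (1 - z) f(z) = (1 - az) f(zq) at zq^k; iterating it leads to f(0) = 1.
  have step : ∀ k : ℕ, (1 - z * q ^ k) * ∑' n, qBinomTerm a q (z * q ^ k) n =
      (1 - a * z * q ^ k) * ∑' n, qBinomTerm a q (z * q ^ (k + 1)) n := by
    intro k
    have hz' := norm_mul_pow_lt_one hz hq k
    have h := tsum_qBinomTerm_mul_one_sub_pow hq hz' a (r := fun _ => 1) (D := 1) (by simp)
    rw [tsum_mul_right, tsum_mul_right] at h
    have e : ∑' n, qBinomTerm a q (z * q ^ (k + 1)) n =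
        ∑' n, qBinomTerm a q (z * q ^ k) n * q ^ n :=
      tsum_congr fun n => by rw [qBinomTerm_mul_pow, qBinomTerm_mul_pow]; ring
    rw [e]
    linear_combination -h
  have iter : ∀ k : ℕ, qPoch z q k * ∑' n, qBinomTerm a q z n =
      qPoch (a * z) q k * ∑' n, qBinomTerm a q z n * (q ^ n) ^ k := by
    intro k
    simp only [← qBinomTerm_mul_pow]
    induction k with
    | zero => simp [qPoch_zero]
    | succ k ih =>
      rw [qPoch_succ, qPoch_succ, mul_right_comm, ih]
      linear_combination qPoch (a * z) q k * step k
  have hlim := tendsto_nhds_unique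
    ((tendsto_qPoch z hq).mul_const (∑' n, qBinomTerm a q z n))
    (((tendsto_qPoch (a * z) hq).mul (tendsto_tsum_mul_pow_pow hu hq)).congr fun k => (iter k).symm)
  rw [eq_div_iff (qPochInf_ne_zero_of_norm_lt_one hz hq), mul_comm, hlim, qBinomTerm_zero, mul_one]

theorem tsum_qBinomTerm_mul_pow_pow {x : ℂ} (hq : ‖q‖ < 1) (hx : ‖x‖ < 1) (hz : ‖z‖ < 1) (a : ℂ)
    (k : ℕ) : ∑' n, qBinomTerm a q z n * (x ^ n) ^ k =
      qPochInf (a * z * x ^ k) q / qPochInf (z * x ^ k) q := by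
  rw [mul_assoc, ← tsum_qBinomTerm hq (norm_mul_pow_lt_one hz hx k) a]
  exact tsum_congr fun n => (qBinomTerm_mul_pow a q z x n k).symm

/-- A bibasic form of Heine's transformation. -/
theorem tsum_bibasic_heine {Q s Z e β : ℂ} (hQ : ‖Q‖ < 1) (hs : ‖s‖ < 1) (hZ : ‖Z‖ < 1)
    (hβ : ‖β‖ < 1) (a : ℂ) :
    ∑' n, qBinomTerm a Q Z n * (qPochInf (e * β * Q ^ n) s / qPochInf (β * Q ^ n) s) =
      ∑' m, qBinomTerm e s β m * (qPochInf (a * Z * Q ^ m) Q / qPochInf (Z * Q ^ m) Q) := by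
  have hu := summable_norm_qBinomTerm hQ hZ a
  have hv := summable_norm_qBinomTerm hs hβ e
  -- Expanding both quotients by the q-binomial theorem makes each side the same absolutely
  -- convergent double sum Σ u_n v_m Q^(nm).
  simp only [← tsum_qBinomTerm_mul_pow_pow hs hQ hβ, ← tsum_qBinomTerm_mul_pow_pow hQ hQ hZ,
    ← tsum_mul_left]
  have hsum : Summable (Function.uncurry fun n m : ℕ =>
      qBinomTerm a Q Z n * (qBinomTerm e s β m * (Q ^ m) ^ n)) := by
    refine Summable.of_norm_bounded (hu.mul_of_nonneg hv (fun _ => norm_nonneg _)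
      fun _ => norm_nonneg _) ?_
    rintro ⟨n, m⟩
    simp only [Function.uncurry, norm_mul]
    rw [← pow_mul]
    refine mul_le_mul_of_nonneg_left ?_ (norm_nonneg _)
    exact mul_le_of_le_one_right (norm_nonneg _) (norm_pow_le_one hQ _)
  rw [← hsum.tsum_comm]
  refine tsum_congr fun m => tsum_congr fun n => ?_
  ring

end QBinomial

/-! ### Uniqueness for a perturbed second order recurrence. -/

section Uniqueness

variable {d x y w : ℕ → ℂ} {δ : ℂ} {r ρ K : ℝ}

/-- With T the shift, the unperturbed operator is (1 - T)(1 - δT). So e_k = d_k - d_(k+1) satisfies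
e_k = δ e_(k+1) + O((rρ)^k). Since |δ|ρ < 1, forward iteration removes the homogeneous part and e_k
= O((rρ)^k); summing the e_k, as d → 0, bounds d. The gain over the given bound is the factor r^n.
-/
theorem norm_le_of_perturbed_recurrence (hr0 : 0 ≤ r) (hr1 : r < 1) (hρ0 : 0 ≤ ρ) (hρ1 : ρ ≤ 1)
    (hδ : ‖δ‖ * ρ < 1) (hx : ∀ k, ‖x k‖ ≤ K * r ^ k) (hy : ∀ k, ‖y k‖ ≤ K * r ^ k)
    (hw : ∀ k, ‖w k‖ ≤ K * r ^ k) (hlim : Tendsto d atTop (𝓝 0))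
    (h : ∀ k, d k - (1 + δ) * d (k + 1) + δ * d (k + 2) =
      x k * d k + y k * d (k + 1) + w k * d (k + 2))
    {n : ℕ} {S : ℝ} (hS0 : 0 ≤ S) (hS : ∀ k, n ≤ k → ‖d k‖ ≤ S * ρ ^ k) :
    ∀ k, n ≤ k → ‖d k‖ ≤ 3 * K / (1 - ‖δ‖ * (r * ρ)) / (1 - r * ρ) * r ^ n * S * ρ ^ k := by
  have hK0 : 0 ≤ K := by simpa using (norm_nonneg _).trans (hx 0)
  have ht0 : 0 ≤ r * ρ := mul_nonneg hr0 hρ0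
  have ht1 : r * ρ < 1 := (mul_le_of_le_one_right hr0 hρ1).trans_lt hr1
  have hδt : ‖δ‖ * (r * ρ) < 1 := by
    refine lt_of_le_of_lt ?_ hδ
    exact mul_le_mul_of_nonneg_left (mul_le_of_le_one_left hρ0 hr1.le) (norm_nonneg _)
  have hρk : ∀ k j, ρ ^ (k + j) ≤ ρ ^ k := fun k j => pow_le_pow_of_le_one hρ0 hρ1 (by omega)
  -- The fixed point of E ↦ |δ|rρE + 3KS, the map that one step of the recurrence induces on the
  -- constant; 3 counts the perturbation terms.
  set E : ℝ := 3 * K * S / (1 - ‖δ‖ * (r * ρ)) with hE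
  have hE' : E * (‖δ‖ * (r * ρ)) + 3 * K * S = E := by
    have h0 : E * (1 - ‖δ‖ * (r * ρ)) = 3 * K * S := div_mul_cancel₀ _ (sub_pos.mpr hδt).ne'
    linarith
  have hE0 : 0 ≤ E := div_nonneg (by positivity) (sub_pos.mpr hδt).le
  have hε : ∀ k, n ≤ k → ‖d k - d (k + 1)‖ ≤
      ‖δ‖ * ‖d (k + 1) - d (k + 2)‖ + 3 * K * S * (r * ρ) ^ k := by
    intro k hk
    have e : d k - d (k + 1) = δ * (d (k + 1) - d (k + 2)) +
        (x k * d k + y k * d (k + 1) + w k * d (k + 2)) := by linear_combination h k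
    have b : ∀ (v : ℕ → ℂ), (∀ k, ‖v k‖ ≤ K * r ^ k) → ∀ j, ‖v k * d (k + j)‖ ≤
        K * S * (r * ρ) ^ k := by
      intro v hv j
      rw [norm_mul, mul_pow]
      calc ‖v k‖ * ‖d (k + j)‖ ≤ (K * r ^ k) * (S * ρ ^ k) :=
            mul_le_mul (hv k) ((hS _ (by omega)).trans (mul_le_mul_of_nonneg_left (hρk k j) hS0))
              (norm_nonneg _) (by positivity)
        _ = _ := by ring
    have b0 := b x hx 0
    have b1 := b y hy 1
    have b2 := b w hw 2
    rw [add_zero] at b0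
    rw [e]
    refine (norm_add_le _ _).trans ?_
    rw [norm_mul]
    have := norm_add₃_le (a := x k * d k) (b := y k * d (k + 1)) (c := w k * d (k + 2))
    linarith
  have hiter : ∀ N k, n ≤ k → ‖d k - d (k + 1)‖ ≤
      2 * S * ρ ^ k * (‖δ‖ * ρ) ^ N + E * (r * ρ) ^ k := by
    intro N
    induction N with
    | zero =>
      intro k hk
      have h1 := hS k hk
      have h2 := (hS (k + 1) (by omega)).trans (mul_le_mul_of_nonneg_left (hρk k 1) hS0)
      have h3 := norm_sub_le (d k) (d (k + 1))
      have h4 : 0 ≤ E * (r * ρ) ^ k := by positivity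
      simp only [pow_zero, mul_one]
      linarith
    | succ N ih =>
      intro k hk
      have h1 := mul_le_mul_of_nonneg_left (ih (k + 1) (by omega)) (norm_nonneg δ)
      refine (hε k hk).trans ((add_le_add_left h1 _).trans (le_of_eq ?_))
      linear_combination (r * ρ) ^ k * hE'
  have he : ∀ k, n ≤ k → ‖d k - d (k + 1)‖ ≤ E * (r * ρ) ^ k := by
    intro k hk
    have hl : Tendsto (fun N : ℕ => 2 * S * ρ ^ k * (‖δ‖ * ρ) ^ N + E * (r * ρ) ^ k) atTop
        (𝓝 (2 * S * ρ ^ k * 0 + E * (r * ρ) ^ k)) :=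
      ((tendsto_pow_atTop_nhds_zero_of_lt_one (by positivity) hδ).const_mul _).add_const _
    rw [mul_zero, zero_add] at hl
    exact ge_of_tendsto' hl fun N => hiter N k hk
  intro k hk
  have hd := dist_le_of_le_geometric_of_tendsto₀ (f := fun j => d (k + j)) (r * ρ)
    (E * (r * ρ) ^ k) ht1 (fun j => by
      rw [dist_eq_norm]
      refine (he (k + j) (by omega)).trans (le_of_eq ?_)
      ring) (hlim.comp (tendsto_add_atTop_nat k |>.congr fun j => add_comm _ _))
  rw [add_zero, dist_zero_right] at hd
  refine hd.trans ?_
  have hrk : r ^ k ≤ r ^ n := pow_le_pow_of_le_one hr0 hr1.le hk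
  have hE1 : 0 ≤ E / (1 - r * ρ) := div_nonneg hE0 (sub_pos.mpr ht1).le
  calc E * (r * ρ) ^ k / (1 - r * ρ) = E / (1 - r * ρ) * ρ ^ k * r ^ k := by ring
    _ ≤ E / (1 - r * ρ) * ρ ^ k * r ^ n := mul_le_mul_of_nonneg_left hrk (by positivity)
    _ = _ := by rw [hE]; ring

/-- Bootstrapping: from an n with T r^n ≤ 1/2 onwards, each use of the previous bound halves S, so d
vanishes there. The recurrence then propagates zero backwards, the coefficient 1 - x k of d k being
nonzero. -/
theorem eq_zero_of_perturbed_recurrence {S : ℝ} (hr0 : 0 ≤ r) (hr1 : r < 1) (hρ0 : 0 ≤ ρ)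
    (hρ1 : ρ ≤ 1) (hδ : ‖δ‖ * ρ < 1) (hx : ∀ k, ‖x k‖ ≤ K * r ^ k)
    (hy : ∀ k, ‖y k‖ ≤ K * r ^ k) (hw : ∀ k, ‖w k‖ ≤ K * r ^ k) (hx1 : ∀ k, 1 - x k ≠ 0)
    (hS : ∀ k, ‖d k‖ ≤ S * ρ ^ k) (hlim : Tendsto d atTop (𝓝 0))
    (h : ∀ k, d k - (1 + δ) * d (k + 1) + δ * d (k + 2) =
      x k * d k + y k * d (k + 1) + w k * d (k + 2)) (k : ℕ) : d k = 0 := by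
  have hS0 : 0 ≤ S := by simpa using (norm_nonneg _).trans (hS 0)
  set T : ℝ := 3 * K / (1 - ‖δ‖ * (r * ρ)) / (1 - r * ρ) with hT
  obtain ⟨n, hn⟩ : ∃ n : ℕ, T * r ^ n ≤ 1 / 2 := by
    have hl : Tendsto (fun n : ℕ => T * r ^ n) atTop (𝓝 (T * 0)) :=
      (tendsto_pow_atTop_nhds_zero_of_lt_one hr0 hr1).const_mul T
    rw [mul_zero] at hl
    exact (hl.eventually_le_const (by norm_num : (0 : ℝ) < 1 / 2)).exists
  have hhalf : ∀ N : ℕ, ∀ k, n ≤ k → ‖d k‖ ≤ S * (1 / 2) ^ N * ρ ^ k := by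
    intro N
    induction N with
    | zero => intro k _; simpa using hS k
    | succ N ih =>
      intro k hk
      have h1 := norm_le_of_perturbed_recurrence hr0 hr1 hρ0 hρ1 hδ hx hy hw hlim h
        (by positivity : 0 ≤ S * (1 / 2) ^ N) ih k hk
      refine h1.trans ?_
      have h2 : T * r ^ n * (S * (1 / 2) ^ N * ρ ^ k) ≤ 1 / 2 * (S * (1 / 2) ^ N * ρ ^ k) :=
        mul_le_mul_of_nonneg_right hn (by positivity)
      rw [pow_succ]
      linarith
  have htail : ∀ k, n ≤ k → d k = 0 := by
    intro k hk
    have hl : Tendsto (fun N : ℕ => S * (1 / 2) ^ N * ρ ^ k) atTop (𝓝 (S * 0 * ρ ^ k)) :=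
      ((tendsto_pow_atTop_nhds_zero_of_lt_one (by norm_num) (by norm_num)).const_mul S).mul_const _
    rw [mul_zero, zero_mul] at hl
    exact norm_le_zero_iff.mp (ge_of_tendsto' hl fun N => hhalf N k hk)
  have hback : ∀ m k, n ≤ k + m → d k = 0 := by
    intro m
    induction m with
    | zero => exact fun k hk => htail k hk
    | succ m ih =>
      intro k hk
      have h1 := ih (k + 1) (by omega)
      have h2 := ih (k + 2) (by omega)
      have h3 := h k
      rw [h1, h2] at h3
      exact (mul_eq_zero.mp (by linear_combination h3 : (1 - x k) * d k = 0)).resolve_left (hx1 k)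
  exact hback n k (by omega)

end Uniqueness

/-! ### Sequences converging to 1 at a geometric rate. -/

section GeometricRate

/-- `f k` differs from `1` by `O(r ^ k)`. -/
def GeomOne (f : ℕ → ℂ) (r : ℝ) : Prop := ∃ D : ℝ, ∀ k, ‖f k - 1‖ ≤ D * r ^ k

variable {f g : ℕ → ℂ} {r : ℝ}

theorem GeomOne.tendsto (hf : GeomOne f r) (hr0 : 0 ≤ r) (hr1 : r < 1) :
    Tendsto f atTop (𝓝 1) := by
  obtain ⟨D, hD⟩ := hf
  rw [tendsto_iff_norm_sub_tendsto_zero]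
  refine squeeze_zero (fun _ => norm_nonneg _) hD ?_
  simpa using (tendsto_pow_atTop_nhds_zero_of_lt_one hr0 hr1).const_mul D

theorem exists_norm_le_of_tendsto {l : ℂ} (hf : Tendsto f atTop (𝓝 l)) : ∃ D, ∀ k, ‖f k‖ ≤ D := by
  obtain ⟨D, hD⟩ := hf.norm.bddAbove_range
  exact ⟨D, fun n => hD ⟨n, rfl⟩⟩

theorem GeomOne.mul (hf : GeomOne f r) (hg : GeomOne g r) (hr0 : 0 ≤ r) (hr1 : r < 1) :
    GeomOne (fun k => f k * g k) r := by
  obtain ⟨G, hG⟩ := exists_norm_le_of_tendsto (hg.tendsto hr0 hr1)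
  obtain ⟨D, hD⟩ := hf
  obtain ⟨D', hD'⟩ := hg
  refine ⟨D * G + D', fun k => ?_⟩
  have hk : 0 ≤ D * r ^ k := (norm_nonneg _).trans (hD k)
  calc ‖f k * g k - 1‖ = ‖(f k - 1) * g k + (g k - 1)‖ := by ring_nf
    _ ≤ ‖f k - 1‖ * ‖g k‖ + ‖g k - 1‖ := by
        rw [← norm_mul]; exact norm_add_le _ _
    _ ≤ D * r ^ k * G + D' * r ^ k :=
        add_le_add (mul_le_mul (hD k) (hG k) (norm_nonneg _) hk) (hD' k)
    _ = _ := by ring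

theorem GeomOne.inv (hf : GeomOne f r) (hr0 : 0 ≤ r) (hr1 : r < 1) (h0 : ∀ k, f k ≠ 0) :
    GeomOne (fun k => (f k)⁻¹) r := by
  obtain ⟨G, hG⟩ := exists_norm_le_of_tendsto ((hf.tendsto hr0 hr1).inv₀ one_ne_zero)
  obtain ⟨D, hD⟩ := hf
  refine ⟨D * G, fun k => ?_⟩
  have hk : 0 ≤ D * r ^ k := (norm_nonneg _).trans (hD k)
  calc ‖(f k)⁻¹ - 1‖ = ‖f k - 1‖ * ‖(f k)⁻¹‖ := by
        rw [← norm_neg, ← norm_mul]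
        congr 1
        have := h0 k
        field_simp
        ring
    _ ≤ D * r ^ k * G := mul_le_mul (hD k) (hG k) (norm_nonneg _) hk
    _ = _ := by ring

theorem geomOne_qPochInf (a : ℂ) {q : ℂ} (hq : ‖q‖ < 1) :
    GeomOne (fun k => qPochInf (a * q ^ k) q) ‖q‖ := by
  set t : ℝ := ‖a‖ / (1 - ‖q‖) with ht
  have ht0 : 0 ≤ t := div_nonneg (norm_nonneg _) (sub_pos.mpr hq).le
  refine ⟨t * Real.exp t, fun k => (norm_qPochInf_sub_one_le _ hq).trans ?_⟩
  have e : ‖a * q ^ k‖ / (1 - ‖q‖) = t * ‖q‖ ^ k := by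
    rw [norm_mul, norm_pow, ht]; ring
  rw [e]
  have hk1 : ‖q‖ ^ k ≤ 1 := pow_le_one₀ (norm_nonneg _) hq.le
  have hk0 : 0 ≤ ‖q‖ ^ k := pow_nonneg (norm_nonneg _) _
  set s : ℝ := t * ‖q‖ ^ k
  have hs0 : 0 ≤ s := mul_nonneg ht0 hk0
  have hst : s ≤ t := mul_le_of_le_one_right ht0 hk1
  -- This is 1 - s ≤ exp(-s) multiplied by exp s.
  have h1 : Real.exp s - 1 ≤ s * Real.exp s := by
    have h2 := Real.add_one_le_exp (-s)
    have h3 : Real.exp (-s) * Real.exp s = 1 := by rw [← Real.exp_add]; simp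
    nlinarith [Real.exp_pos s]
  calc Real.exp s - 1 ≤ s * Real.exp s := h1
    _ ≤ s * Real.exp t := mul_le_mul_of_nonneg_left (Real.exp_le_exp.mpr hst) hs0
    _ = _ := by simp only [s]; ring

theorem norm_tsum_shift_sub_le {u : ℕ → ℂ} (hu : Summable fun n => ‖u n‖) {D : ℝ}
    (hr0 : 0 ≤ r) (hr1 : r < 1) (hf : ∀ k, ‖f k - 1‖ ≤ D * r ^ k) (k : ℕ) :
    ‖∑' n, u n * f (n + k) - ∑' n, u n‖ ≤ ((∑' n, ‖u n‖) * D) * r ^ k := by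
  obtain ⟨G, hG⟩ := exists_norm_le_of_tendsto (GeomOne.tendsto ⟨D, hf⟩ hr0 hr1)
  have hs := (summable_norm_mul_of_bounded hu fun n => hG (n + k)).of_norm
  have hD : 0 ≤ D := by simpa using (norm_nonneg _).trans (hf 0)
  rw [← hs.tsum_sub hu.of_norm, ← tsum_mul_right, ← tsum_mul_right]
  refine tsum_of_norm_bounded ((hu.mul_right _).mul_right _).hasSum fun n => ?_
  rw [← mul_sub_one, norm_mul, mul_assoc]
  refine mul_le_mul_of_nonneg_left ((hf _).trans (mul_le_mul_of_nonneg_left ?_ hD))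
    (norm_nonneg _)
  exact pow_le_pow_of_le_one hr0 hr1.le (by omega)

end GeometricRate

/-! ### Rogers generating functions and their q-difference equation. -/

section Rogers

/-- The generating function of the Rogers polynomials, `(βB, βC; p)_∞ / (B, C; p)_∞`, at
`(B p^m, C p^m)`. -/
noncomputable def rogersRatio (p β B C : ℂ) (m : ℕ) : ℂ :=
  qPochInf (β * B * p ^ m) p * qPochInf (β * C * p ^ m) p /
    (qPochInf (B * p ^ m) p * qPochInf (C * p ^ m) p)

/-- A `q`-binomial weighted sum of shifted Rogers generating functions. -/
noncomputable def rogersSum (p A z β B C : ℂ) (j k : ℕ) : ℂ :=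
  ∑' m, qBinomTerm A p z m * (p ^ m) ^ j * rogersRatio p β B C (m + k)

variable {p A z β B C δ : ℂ}

theorem qPochInf_mul_pow (a : ℂ) {q : ℂ} (hq : ‖q‖ < 1) (k : ℕ) :
    qPochInf (a * q ^ k) q = (1 - a * q ^ k) * qPochInf (a * q ^ (k + 1)) q := by
  rw [qPochInf_eq_mul _ hq, pow_succ, mul_assoc]

theorem rogersRatio_succ (hp : ‖p‖ < 1) (hB : ‖B‖ < 1) (hC : ‖C‖ < 1) (m : ℕ) :
    (1 - B * p ^ m) * (1 - C * p ^ m) * rogersRatio p β B C m =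
      (1 - β * B * p ^ m) * (1 - β * C * p ^ m) * rogersRatio p β B C (m + 1) := by
  have h1 := one_sub_ne_zero_of_norm_lt_one (norm_mul_pow_lt_one hB hp m)
  have h2 := one_sub_ne_zero_of_norm_lt_one (norm_mul_pow_lt_one hC hp m)
  have h3 := qPochInf_ne_zero_of_norm_lt_one (norm_mul_pow_lt_one hB hp (m + 1)) hp
  have h4 := qPochInf_ne_zero_of_norm_lt_one (norm_mul_pow_lt_one hC hp (m + 1)) hp
  simp only [rogersRatio]
  rw [qPochInf_mul_pow (β * B) hp, qPochInf_mul_pow (β * C) hp, qPochInf_mul_pow B hp,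
    qPochInf_mul_pow C hp]
  generalize 1 - B * p ^ m = x1 at *
  generalize 1 - C * p ^ m = x2 at *
  field_simp

theorem geomOne_rogersRatio (hp : ‖p‖ < 1) (hB : ‖B‖ < 1) (hC : ‖C‖ < 1) :
    GeomOne (rogersRatio p β B C) ‖p‖ := by
  have h := ((geomOne_qPochInf (β * B) hp).mul (geomOne_qPochInf (β * C) hp)
    (norm_nonneg _) hp).mul (((geomOne_qPochInf B hp).mul (geomOne_qPochInf C hp)
    (norm_nonneg _) hp).inv (norm_nonneg _) hp fun k => mul_ne_zero
      (qPochInf_ne_zero_of_norm_lt_one (norm_mul_pow_lt_one hB hp k) hp)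
      (qPochInf_ne_zero_of_norm_lt_one (norm_mul_pow_lt_one hC hp k) hp)) (norm_nonneg _) hp
  exact h

theorem exists_norm_rogersRatio_le (hp : ‖p‖ < 1) (hB : ‖B‖ < 1) (hC : ‖C‖ < 1) :
    ∃ D, ∀ m, ‖rogersRatio p β B C m‖ ≤ D :=
  exists_norm_le_of_tendsto ((geomOne_rogersRatio hp hB hC).tendsto (norm_nonneg _) hp)

theorem summable_rogersSum (hp : ‖p‖ < 1) (hz : ‖z‖ < 1) (hB : ‖B‖ < 1) (hC : ‖C‖ < 1)
    (j k : ℕ) :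
    Summable fun m => qBinomTerm A p z m * (p ^ m) ^ j * rogersRatio p β B C (m + k) := by
  obtain ⟨D, hD⟩ := exists_norm_rogersRatio_le (β := β) hp hB hC
  exact (summable_norm_mul_of_bounded (summable_norm_mul_pow_pow (summable_norm_qBinomTerm hp hz A)
    hp j) fun m => hD (m + k)).of_norm

theorem rogersSum_weight (hp : ‖p‖ < 1) (hz : ‖z‖ < 1) (hB : ‖B‖ < 1) (hC : ‖C‖ < 1) (j k : ℕ) :
    rogersSum p A z β B C (j + 1) k - A * z * p ^ j * rogersSum p A z β B C (j + 1) (k + 1) =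
      rogersSum p A z β B C j k - z * p ^ j * rogersSum p A z β B C j (k + 1) := by
  obtain ⟨D, hD⟩ := exists_norm_rogersRatio_le (β := β) hp hB hC
  have h := tsum_qBinomTerm_mul_one_sub_pow hp hz A
    (r := fun m => (p ^ m) ^ j * rogersRatio p β B C (m + k)) (D := 1 * D) fun m => by
      rw [norm_mul, ← pow_mul]
      exact mul_le_mul (norm_pow_le_one hp _) (hD _) (norm_nonneg _) zero_le_one
  simp only [rogersSum]
  rw [← tsum_mul_left, ← tsum_mul_left,
    ← (summable_rogersSum hp hz hB hC _ _).tsum_sub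
      ((summable_rogersSum hp hz hB hC _ _).mul_left _),
    ← (summable_rogersSum hp hz hB hC _ _).tsum_sub
      ((summable_rogersSum hp hz hB hC _ _).mul_left _)]
  refine Eq.trans (tsum_congr fun m => ?_) (h.trans (tsum_congr fun m => ?_))
  · rw [show m + (k + 1) = m + 1 + k by ring]; ring
  · rw [show m + (k + 1) = m + 1 + k by ring]; ring

/-- `rogersRatio_succ` at m + k, expanded in powers of p^m and summed: each power of p^m raises the
moment index j by one. -/
theorem rogersSum_shift (hp : ‖p‖ < 1) (hz : ‖z‖ < 1) (hB : ‖B‖ < 1) (hC : ‖C‖ < 1) (j k : ℕ) :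
    rogersSum p A z β B C j k - rogersSum p A z β B C j (k + 1) =
      p ^ k * (B + C) * (rogersSum p A z β B C (j + 1) k -
        β * rogersSum p A z β B C (j + 1) (k + 1)) -
      (p ^ k) ^ 2 * (B * C) * (rogersSum p A z β B C (j + 2) k -
        β ^ 2 * rogersSum p A z β B C (j + 2) (k + 1)) := by
  have s := fun i l => summable_rogersSum (A := A) (β := β) hp hz hB hC i l
  simp only [rogersSum]
  rw [← tsum_mul_left, ← tsum_mul_left, ← (s _ _).tsum_sub (s _ _),
    ← (s _ _).tsum_sub ((s _ _).mul_left _), ← (s _ _).tsum_sub ((s _ _).mul_left _),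
    ← tsum_mul_left, ← tsum_mul_left,
    ← (((s _ _).sub ((s _ _).mul_left _)).mul_left _).tsum_sub
      (((s _ _).sub ((s _ _).mul_left _)).mul_left _)]
  refine tsum_congr fun m => ?_
  have h := rogersRatio_succ (β := β) hp hB hC (m + k)
  rw [pow_add] at h
  rw [← add_assoc]
  linear_combination qBinomTerm A p z m * (p ^ m) ^ j * h

theorem norm_rogersSum_sub_le (hp : ‖p‖ < 1) (hz : ‖z‖ < 1) (hB : ‖B‖ < 1) (hC : ‖C‖ < 1)
    (A β : ℂ) (j : ℕ) : ∃ D, ∀ k, ‖rogersSum p A z β B C j k -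
      ∑' m, qBinomTerm A p z m * (p ^ m) ^ j‖ ≤ D * ‖p‖ ^ k := by
  obtain ⟨D, hD⟩ := geomOne_rogersRatio (β := β) hp hB hC
  exact ⟨_, fun k => norm_tsum_shift_sub_le (summable_norm_mul_pow_pow
    (summable_norm_qBinomTerm hp hz A) hp j) (norm_nonneg _) hp hD k⟩

theorem tendsto_of_norm_sub_le {f : ℕ → ℂ} {l : ℂ} {D r : ℝ} (hr0 : 0 ≤ r) (hr1 : r < 1)
    (h : ∀ k, ‖f k - l‖ ≤ D * r ^ k) : Tendsto f atTop (𝓝 l) := by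
  rw [tendsto_iff_norm_sub_tendsto_zero]
  refine squeeze_zero (fun _ => norm_nonneg _) h ?_
  simpa using (tendsto_pow_atTop_nhds_zero_of_lt_one hr0 hr1).const_mul D

theorem tendsto_rogersSum (hp : ‖p‖ < 1) (hz : ‖z‖ < 1) (hB : ‖B‖ < 1) (hC : ‖C‖ < 1)
    (A β : ℂ) (j : ℕ) : Tendsto (rogersSum p A z β B C j) atTop
      (𝓝 (∑' m, qBinomTerm A p z m * (p ^ m) ^ j)) := by
  obtain ⟨D, hD⟩ := norm_rogersSum_sub_le hp hz hB hC A β j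
  exact tendsto_of_norm_sub_le (norm_nonneg _) hp hD

/-- The second order `q`-difference equation of `∑ (γ;p)_N / (β²;p)_N C_N(B, C; β | p) x^N`, for a
sequence `f` of values along `x = p^k`. -/
def RogersEquation (p δ z β B C : ℂ) (f : ℕ → ℂ) : Prop := ∀ k,
  f k - (1 + δ) * f (k + 1) + δ * f (k + 2) =
    p ^ k * (B + C) * (f k - (β + z) * f (k + 1) + β * z * f (k + 2)) -
    (p ^ k) ^ 2 * (B * C) * (f k - (z * p + z) * f (k + 1) + z ^ 2 * p * f (k + 2))

/-- Subtract δ times the shift relation at k + 1 from the one at k. Because δp = Az, the moments K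
of index 1 enter only through K_k - Az K_(k+1), which `rogersSum_weight` reduces to index 0. Because
β² = Az, the moments of index 2 group into combinations that the weight relation reduces to index 1
and then to index 0. -/
theorem rogersEquation_rogersSum (hp : ‖p‖ < 1) (hz : ‖z‖ < 1) (hB : ‖B‖ < 1) (hC : ‖C‖ < 1)
    (hβ : β ^ 2 = A * z) (hδ : δ * p = A * z) :
    RogersEquation p δ z β B C (rogersSum p A z β B C 0) := by
  intro k
  have e0 := rogersSum_shift (A := A) (β := β) hp hz hB hC 0 k
  have e1 := rogersSum_shift (A := A) (β := β) hp hz hB hC 0 (k + 1)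
  have u0 := rogersSum_weight (A := A) (β := β) hp hz hB hC 0 k
  have u1 := rogersSum_weight (A := A) (β := β) hp hz hB hC 0 (k + 1)
  have v0 := rogersSum_weight (A := A) (β := β) hp hz hB hC 1 k
  have v1 := rogersSum_weight (A := A) (β := β) hp hz hB hC 1 (k + 1)
  have d1 : δ * p ^ (k + 1) = A * z * p ^ k := by linear_combination p ^ k * hδ
  have d2 : δ * (p ^ (k + 1)) ^ 2 = A * z * p * (p ^ k) ^ 2 := by
    linear_combination p * (p ^ k) ^ 2 * hδ
  rw [hβ] at e0 e1
  simp only [zero_add, pow_zero, pow_one, mul_one, add_assoc, Nat.reduceAdd] at e0 e1 u0 u1 v0 v1 ⊢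
  generalize rogersSum p A z β B C 0 k = F0 at *
  generalize rogersSum p A z β B C 0 (k + 1) = F1 at *
  generalize rogersSum p A z β B C 0 (k + 2) = F2 at *
  generalize rogersSum p A z β B C 1 k = K0 at *
  generalize rogersSum p A z β B C 1 (k + 1) = K1 at *
  generalize rogersSum p A z β B C 1 (k + 2) = K2 at *
  generalize rogersSum p A z β B C 2 k = M0 at *
  generalize rogersSum p A z β B C 2 (k + 1) = M1 at *
  generalize rogersSum p A z β B C 2 (k + 2) = M2 at *
  linear_combination e0 - δ * e1 - (B + C) * (K1 - β * K2) * d1 + B * C * (M1 - A * z * M2) * d2 +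
    (B + C) * p ^ k * (u0 - β * u1) -
    B * C * (p ^ k) ^ 2 * (v0 - A * z * v1 + u0 - z * p * u1)

/-- The right side of the equation is a perturbation with coefficients O(|p|^k), and the total
coefficient of f k is (1 - Bp^k)(1 - Cp^k) ≠ 0, so the uniqueness lemma applies to f - g. -/
theorem rogersEquation_unique (hp : ‖p‖ < 1) (hB : ‖B‖ < 1) (hC : ‖C‖ < 1) {ρ D : ℝ}
    (hρ0 : 0 ≤ ρ) (hρ1 : ρ ≤ 1) (hδ : ‖δ‖ * ρ < 1) {f g : ℕ → ℂ}
    (hf : RogersEquation p δ z β B C f) (hg : RogersEquation p δ z β B C g)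
    (hD : ∀ k, ‖f k - g k‖ ≤ D * ρ ^ k) (hlim : Tendsto (fun k => f k - g k) atTop (𝓝 0)) (k : ℕ) :
    f k = g k := by
  set b : ℂ := B + C
  set c : ℂ := B * C
  set y1 : ℂ := β + z
  set y2 : ℂ := z * p + z
  set w1 : ℂ := β * z
  set w2 : ℂ := z ^ 2 * p
  set K : ℝ := ‖b‖ * (1 + ‖y1‖ + ‖w1‖) + ‖c‖ * (1 + ‖y2‖ + ‖w2‖) with hK
  have bd : ∀ s t : ℂ, ‖s‖ ≤ 1 + ‖y1‖ + ‖w1‖ → ‖t‖ ≤ 1 + ‖y2‖ + ‖w2‖ → ∀ k : ℕ,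
      ‖p ^ k * b * s - (p ^ k) ^ 2 * c * t‖ ≤ K * ‖p‖ ^ k := by
    intro s t hs ht k
    have h1 : ‖p ^ k * b * s‖ ≤ ‖b‖ * (1 + ‖y1‖ + ‖w1‖) * ‖p‖ ^ k := by
      rw [norm_mul, norm_mul, norm_pow]
      calc ‖p‖ ^ k * ‖b‖ * ‖s‖ ≤ ‖p‖ ^ k * ‖b‖ * (1 + ‖y1‖ + ‖w1‖) :=
            mul_le_mul_of_nonneg_left hs (by positivity)
        _ = _ := by ring
    have h2 : ‖(p ^ k) ^ 2 * c * t‖ ≤ ‖c‖ * (1 + ‖y2‖ + ‖w2‖) * ‖p‖ ^ k := by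
      rw [norm_mul, norm_mul, norm_pow, norm_pow]
      have h3 : (‖p‖ ^ k) ^ 2 ≤ ‖p‖ ^ k := by
        rw [sq]
        exact mul_le_of_le_one_right (by positivity) (pow_le_one₀ (norm_nonneg _) hp.le)
      calc (‖p‖ ^ k) ^ 2 * ‖c‖ * ‖t‖ ≤ ‖p‖ ^ k * ‖c‖ * (1 + ‖y2‖ + ‖w2‖) :=
            mul_le_mul (mul_le_mul_of_nonneg_right h3 (norm_nonneg _)) ht (norm_nonneg _)
              (by positivity)
        _ = _ := by ring
    refine (norm_sub_le _ _).trans ?_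
    rw [hK, add_mul]
    exact add_le_add h1 h2
  have n0 : ∀ s : ℂ, 0 ≤ ‖s‖ := fun s => norm_nonneg s
  have := eq_zero_of_perturbed_recurrence (d := fun k => f k - g k) (δ := δ)
    (x := fun k => p ^ k * b * 1 - (p ^ k) ^ 2 * c * 1)
    (y := fun k => p ^ k * b * (-y1) - (p ^ k) ^ 2 * c * (-y2))
    (w := fun k => p ^ k * b * w1 - (p ^ k) ^ 2 * c * w2)
    (norm_nonneg p) hp hρ0 hρ1 hδ
    (bd _ _ (by rw [norm_one]; linarith [n0 y1, n0 w1]) (by rw [norm_one]; linarith [n0 y2, n0 w2]))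
    (bd _ _ (by rw [norm_neg]; linarith [n0 y1, n0 w1]) (by rw [norm_neg]; linarith [n0 y2, n0 w2]))
    (bd _ _ (by linarith [n0 y1, n0 w1]) (by linarith [n0 y2, n0 w2]))
    (fun k => by
      have h1 := one_sub_ne_zero_of_norm_lt_one (norm_mul_pow_lt_one hB hp k)
      have h2 := one_sub_ne_zero_of_norm_lt_one (norm_mul_pow_lt_one hC hp k)
      have e : 1 - (p ^ k * b * 1 - (p ^ k) ^ 2 * c * 1) = (1 - B * p ^ k) * (1 - C * p ^ k) := by
        simp only [b, c]; ring
      rw [e]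
      exact mul_ne_zero h1 h2)
    hD hlim (fun k => by
      simp only [b, c, y1, y2, w1, w2]
      linear_combination hf k - hg k) k
  exact sub_eq_zero.mp this

theorem RogersEquation.const_mul {f : ℕ → ℂ} (hf : RogersEquation p δ z β B C f) (c : ℂ) :
    RogersEquation p δ z β B C fun k => c * f k := fun k => by linear_combination c * hf k

end Rogers

/-! ### Rogers sums as quadratic ₂φ₁ series, base q. -/

section QuadraticTransformations

variable {p q A z β B C δ κ x : ℂ}

/-- As k → ∞ the Rogers sum tends to a q-binomial series, which fixes the constant. Both sides
approach their limit like |p|^k, and |δ||p| = |Az| < 1 is the condition for uniqueness. -/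
theorem rogersSum_eq_of_rogersEquation (hp : ‖p‖ < 1) (hz : ‖z‖ < 1) (hB : ‖B‖ < 1)
    (hC : ‖C‖ < 1) (hAz : ‖A * z‖ < 1) (hβ : β ^ 2 = A * z) (hδ : δ * p = A * z) {W : ℕ → ℂ}
    (hW : RogersEquation p δ z β B C W) (hW1 : GeomOne W ‖p‖) (k : ℕ) :
    rogersSum p A z β B C 0 k = qPochInf (A * z) p / qPochInf z p * W k := by
  obtain ⟨D, hD⟩ := norm_rogersSum_sub_le hp hz hB hC A β 0
  obtain ⟨D', hD'⟩ := hW1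
  simp only [pow_zero, mul_one, tsum_qBinomTerm hp hz] at hD
  set c := qPochInf (A * z) p / qPochInf z p
  have hbd : ∀ k, ‖rogersSum p A z β B C 0 k - c * W k‖ ≤ (D + ‖c‖ * D') * ‖p‖ ^ k := by
    intro k
    calc ‖rogersSum p A z β B C 0 k - c * W k‖
        = ‖(rogersSum p A z β B C 0 k - c) - c * (W k - 1)‖ := by ring_nf
      _ ≤ ‖rogersSum p A z β B C 0 k - c‖ + ‖c‖ * ‖W k - 1‖ := by
          rw [← norm_mul]; exact norm_sub_le _ _
      _ ≤ D * ‖p‖ ^ k + ‖c‖ * (D' * ‖p‖ ^ k) :=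
          add_le_add (hD k) (mul_le_mul_of_nonneg_left (hD' k) (norm_nonneg _))
      _ = _ := by ring
  refine rogersEquation_unique hp hB hC (norm_nonneg p) hp.le (by rwa [← norm_mul, hδ])
    (rogersEquation_rogersSum hp hz hB hC hβ hδ) (hW.const_mul c) hbd ?_ k
  exact tendsto_of_norm_sub_le (norm_nonneg p) hp fun k => by simpa using hbd k

theorem tsum_eq_tsum_of_succ {F G : ℕ → ℂ} (hF : Summable F) (h0 : F 0 = 0)
    (h : ∀ n, F (n + 1) = G n) : ∑' n, F n = ∑' n, G n := by
  rw [hF.tsum_eq_zero_add, h0, zero_add]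
  exact tsum_congr h

theorem norm_sq_lt_one (hq : ‖q‖ < 1) : ‖q ^ 2‖ < 1 := by
  rw [norm_pow]; exact pow_lt_one₀ (norm_nonneg _) hq two_ne_zero

theorem norm_mul_lt_one_of_lt_of_lt {s t : ℂ} (hs : ‖s‖ < 1) (ht : ‖t‖ < 1) : ‖s * t‖ < 1 := by
  simpa using norm_mul_pow_lt_one hs ht 1

/-- The `n`-th term of `₂φ₁(x, xq; A²q; q², B²)`. -/
noncomputable def quadTerm (q A x B : ℂ) (n : ℕ) : ℂ :=
  qPoch x q (2 * n) / (qPoch (q ^ 2) (q ^ 2) n * qPoch (A ^ 2 * q) (q ^ 2) n) * (B ^ 2) ^ n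

theorem quadTerm_succ (hq : ‖q‖ < 1) (hA : ‖A‖ < 1) (x B : ℂ) (n : ℕ) :
    quadTerm q A x B (n + 1) * ((1 - q ^ 2 * (q ^ 2) ^ n) * (1 - A ^ 2 * q * (q ^ 2) ^ n)) =
      quadTerm q A x B n * ((1 - x * q ^ (2 * n)) * (1 - x * q ^ (2 * n + 1)) * B ^ 2) := by
  have hq2 := norm_sq_lt_one hq
  have hAq := norm_mul_lt_one_of_lt_of_lt (norm_sq_lt_one hA) hq
  have h1 := one_sub_ne_zero_of_norm_lt_one (norm_mul_pow_lt_one hq2 hq2 n)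
  have h2 := one_sub_ne_zero_of_norm_lt_one (norm_mul_pow_lt_one hAq hq2 n)
  have h3 := qPoch_ne_zero hq2 hq2 n
  have h4 := qPoch_ne_zero hAq hq2 n
  simp only [quadTerm, show 2 * (n + 1) = 2 * n + 1 + 1 by ring, qPoch_succ]
  generalize 1 - q ^ 2 * (q ^ 2) ^ n = x1 at *
  generalize 1 - A ^ 2 * q * (q ^ 2) ^ n = x2 at *
  field_simp
  ring

theorem summable_norm_quadTerm (hq : ‖q‖ < 1) (hA : ‖A‖ < 1) (hB : ‖B‖ < 1) (x : ℂ) :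
    Summable fun n => ‖quadTerm q A x B n‖ := by
  have hq2 := norm_sq_lt_one hq
  have hAq := norm_mul_lt_one_of_lt_of_lt (norm_sq_lt_one hA) hq
  refine summable_norm_of_succ_eq_mul (l := (1 - 0) * (1 - 0) * B ^ 2 / ((1 - 0) * (1 - 0)))
    (fun n => ?_) (((((tendsto_mul_pow x hq).comp (tendsto_id.const_mul_atTop' two_pos)).const_sub
      1).mul (((tendsto_mul_pow x hq).comp ((tendsto_add_atTop_nat 1).comp
      (tendsto_id.const_mul_atTop' two_pos))).const_sub 1)).mul_const (B ^ 2) |>.div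
      (((tendsto_mul_pow (q ^ 2) hq2).const_sub 1).mul
      ((tendsto_mul_pow (A ^ 2 * q) hq2).const_sub 1)) (by simp)) (by simpa using hB)
  have h1 := one_sub_ne_zero_of_norm_lt_one (norm_mul_pow_lt_one hq2 hq2 n)
  have h2 := one_sub_ne_zero_of_norm_lt_one (norm_mul_pow_lt_one hAq hq2 n)
  simp only [Pi.div_apply, Function.comp_apply, id]
  rw [← mul_div_assoc, eq_div_iff (mul_ne_zero h1 h2), quadTerm_succ hq hA]

theorem geomOne_tsum_quadTerm (hq : ‖q‖ < 1) (hA : ‖A‖ < 1) (hB : ‖B‖ < 1) (x : ℂ) :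
    GeomOne (fun k => ∑' n, quadTerm q A x B n * ((q ^ 2) ^ n) ^ k) ‖q‖ := by
  have hs := summable_norm_quadTerm hq hA hB x
  have h0 : quadTerm q A x B 0 = 1 := by simp [quadTerm, qPoch_zero]
  refine ⟨∑' n, ‖quadTerm q A x B (n + 1)‖, fun k => ?_⟩
  have h := norm_tsum_mul_pow_pow_sub_le hs (norm_sq_lt_one hq) k
  rw [h0] at h
  refine h.trans (mul_le_mul_of_nonneg_left ?_ (tsum_nonneg fun _ => norm_nonneg _))
  rw [norm_pow, ← pow_mul]
  exact pow_le_pow_of_le_one (norm_nonneg _) hq.le (by omega)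

/-- Replacing B by Bq^k multiplies the n-th term by (q²)^(nk), so this is the q-difference equation
of the series in B, read off from the term ratio. -/
theorem tsum_quadTerm_recurrence (hq : ‖q‖ < 1) (hA : ‖A‖ < 1) (hB : ‖B‖ < 1) (x : ℂ)
    (hδ : δ * q = A ^ 2) (k : ℕ) {Γ : ℕ → ℂ}
    (hΓ : ∀ k, Γ k = ∑' n, quadTerm q A x B n * ((q ^ 2) ^ n) ^ k) :
    Γ k - (1 + δ) * Γ (k + 1) + δ * Γ (k + 2) =
      B ^ 2 * (q ^ k) ^ 2 * (Γ k - (x + x * q) * Γ (k + 1) + x ^ 2 * q * Γ (k + 2)) := by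
  have s : ∀ j, HasSum (fun n => quadTerm q A x B n * ((q ^ 2) ^ n) ^ j) (Γ j) := fun j => by
    rw [hΓ]
    exact (summable_norm_mul_pow_pow (summable_norm_quadTerm hq hA hB x)
      (norm_sq_lt_one hq) j).of_norm.hasSum
  have l := ((s k).sub ((s (k + 1)).mul_left (1 + δ))).add ((s (k + 2)).mul_left δ)
  have r := (((s k).sub ((s (k + 1)).mul_left (x + x * q))).add
    ((s (k + 2)).mul_left (x ^ 2 * q))).mul_left (B ^ 2 * (q ^ k) ^ 2)
  rw [← l.tsum_eq, ← r.tsum_eq]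
  refine tsum_eq_tsum_of_succ l.summable (by simp; ring) fun n => ?_
  have h := quadTerm_succ hq hA x B n
  rw [← hδ] at h
  have e1 : ((q ^ 2) ^ (n + 1)) ^ k = ((q ^ 2) ^ n) ^ k * (q ^ k) ^ 2 := by ring
  have e2 : ∀ i, ((q ^ 2) ^ (n + 1)) ^ (k + i) =
      ((q ^ 2) ^ n) ^ k * (q ^ k) ^ 2 * (q ^ 2 * (q ^ 2) ^ n) ^ i := fun i => by ring
  have e3 : ∀ i, ((q ^ 2) ^ n) ^ (k + i) = ((q ^ 2) ^ n) ^ k * ((q ^ 2) ^ n) ^ i :=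
    fun i => by ring
  rw [e1, e2, e2, e3, e3]
  rw [pow_succ q, pow_mul] at h
  linear_combination ((q ^ 2) ^ n) ^ k * (q ^ k) ^ 2 * h

/-- For z = A and β = -A the coefficient β + z vanishes, and multiplication by the products `P`
carries the equation of the quadratic series into the Rogers equation. -/
theorem rogersSum_eq_quadratic (hq0 : q ≠ 0) (hq : ‖q‖ < 1) (hA : ‖A‖ < 1) (hB : ‖B‖ < 1)
    (hC : ‖κ * B‖ < 1) :
    rogersSum q A A (-A) B (κ * B) 0 0 =
      qPochInf (A ^ 2) q / qPochInf A q * (qPochInf (-B) q / qPochInf (κ * B) q *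
        ∑' n, quadTerm q A (-(A * κ)) B n) := by
  set Γ : ℕ → ℂ := fun k => ∑' n, quadTerm q A (-(A * κ)) B n * ((q ^ 2) ^ n) ^ k with hΓ
  set P : ℕ → ℂ := fun k => qPochInf (-B * q ^ k) q * (qPochInf (κ * B * q ^ k) q)⁻¹ with hP
  have hδ : A ^ 2 / q * q = A ^ 2 := div_mul_cancel₀ _ hq0
  have hCk := fun k => qPochInf_ne_zero_of_norm_lt_one (norm_mul_pow_lt_one hC hq k) hq
  have h := rogersSum_eq_of_rogersEquation (p := q) (A := A) (z := A) (β := -A) (B := B)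
    (C := κ * B) (δ := A ^ 2 / q) (W := fun k => P k * Γ k) hq hA hB hC
    (norm_mul_lt_one_of_lt_of_lt hA hA) (by ring) (by rw [hδ]; ring) ?_ ?_ 0
  · rw [h]
    simp only [hP, hΓ, pow_zero, mul_one, div_eq_mul_inv]
    ring_nf
  · intro k
    have hΓk := tsum_quadTerm_recurrence hq hA hB (-(A * κ)) hδ k (Γ := Γ) fun _ => rfl
    -- P k, P (k + 1) and P (k + 2) are polynomial multiples of S, so the identity to check has no
    -- denominators.
    set S := P (k + 2) / ((1 - κ * B * q ^ k) * (1 - κ * B * q ^ (k + 1))) with hS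
    have n0 := one_sub_ne_zero_of_norm_lt_one (norm_mul_pow_lt_one hC hq k)
    have n1 := one_sub_ne_zero_of_norm_lt_one (norm_mul_pow_lt_one hC hq (k + 1))
    have r : ∀ j, P j * (1 - κ * B * q ^ j) = P (j + 1) * (1 + B * q ^ j) := by
      intro j
      have h1 := hCk (j + 1)
      have h2 := one_sub_ne_zero_of_norm_lt_one (norm_mul_pow_lt_one hC hq j)
      simp only [hP]
      rw [qPochInf_mul_pow (-B) hq, qPochInf_mul_pow (κ * B) hq]
      generalize 1 - κ * B * q ^ j = x1 at *
      field_simp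
      ring
    have p2 : P (k + 2) = (1 - κ * B * q ^ k) * (1 - κ * B * q ^ (k + 1)) * S := by
      rw [hS, mul_div_cancel₀ _ (mul_ne_zero n0 n1)]
    have p1 : P (k + 1) = (1 - κ * B * q ^ k) * (1 + B * q ^ (k + 1)) * S :=
      mul_right_cancel₀ n1 (by rw [r, p2]; ring)
    have p0 : P k = (1 + B * q ^ k) * (1 + B * q ^ (k + 1)) * S :=
      mul_right_cancel₀ n0 (by rw [r, p1]; ring)
    simp only [p0, p1, p2]
    rw [pow_succ q k]
    clear_value S Γ
    generalize A ^ 2 / q = δ at *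
    linear_combination S * (1 - κ * B * q ^ k) * (1 + B * q * q ^ k) * hΓk -
      Γ (k + 2) * S * (1 - κ * B * q ^ k) * ((1 - κ * B * q * q ^ k) * (q ^ k * (B + κ * B) +
        (q ^ k) ^ 2 * (B * (κ * B)) * q) +
        (1 + B * q * q ^ k) * (κ * B) ^ 2 * (q ^ k) ^ 2 * q) * hδ
  · have hg := (geomOne_qPochInf (-B) hq).mul ((geomOne_qPochInf (κ * B) hq).inv
      (norm_nonneg _) hq hCk) (norm_nonneg _) hq
    exact hg.mul (geomOne_tsum_quadTerm hq hA hB _) (norm_nonneg _) hq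

end QuadraticTransformations

/-! ### Rogers sums in base q² as series in base q. -/

section QuadraticTransformationsBaseSquared

variable {q A B κ x : ℂ}

/-- The `n`-th term of `∑ (x;q²)_n / (q, -Aq; q)_n B^n`. -/
noncomputable def signTerm (q A x B : ℂ) (n : ℕ) : ℂ :=
  qPoch x (q ^ 2) n / (qPoch q q n * qPoch (-(A * q)) q n) * B ^ n

theorem signTerm_succ (hq : ‖q‖ < 1) (hA : ‖A‖ < 1) (x B : ℂ) (n : ℕ) :
    signTerm q A x B (n + 1) * ((1 - q * q ^ n) * (1 - -(A * q) * q ^ n)) =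
      signTerm q A x B n * ((1 - x * (q ^ 2) ^ n) * B) := by
  have hAq : ‖-(A * q)‖ < 1 := by rw [norm_neg]; exact norm_mul_lt_one_of_lt_of_lt hA hq
  have h1 := one_sub_ne_zero_of_norm_lt_one (norm_mul_pow_lt_one hq hq n)
  have h2 := one_sub_ne_zero_of_norm_lt_one (norm_mul_pow_lt_one hAq hq n)
  have h3 := qPoch_ne_zero hq hq n
  have h4 := qPoch_ne_zero hAq hq n
  simp only [signTerm, qPoch_succ]
  generalize 1 - q * q ^ n = x1 at *
  generalize 1 - -(A * q) * q ^ n = x2 at *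
  generalize qPoch (-(A * q)) q n = x3 at *
  field_simp
  ring

theorem summable_norm_signTerm (hq : ‖q‖ < 1) (hA : ‖A‖ < 1) (hB : ‖B‖ < 1) (x : ℂ) :
    Summable fun n => ‖signTerm q A x B n‖ := by
  have hAq : ‖-(A * q)‖ < 1 := by rw [norm_neg]; exact norm_mul_lt_one_of_lt_of_lt hA hq
  refine summable_norm_of_succ_eq_mul (l := (1 - 0) * B / ((1 - 0) * (1 - 0)))
    (fun n => ?_) (((tendsto_mul_pow x (norm_sq_lt_one hq)).const_sub 1).mul_const B |>.div
      (((tendsto_mul_pow q hq).const_sub 1).mul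
      ((tendsto_mul_pow (-(A * q)) hq).const_sub 1)) (by simp)) (by simpa using hB)
  have h1 := one_sub_ne_zero_of_norm_lt_one (norm_mul_pow_lt_one hq hq n)
  have h2 := one_sub_ne_zero_of_norm_lt_one (norm_mul_pow_lt_one hAq hq n)
  simp only [Pi.div_apply]
  rw [← mul_div_assoc, eq_div_iff (mul_ne_zero h1 h2), signTerm_succ hq hA]

theorem geomOne_tsum_signTerm (hq : ‖q‖ < 1) (hA : ‖A‖ < 1) (hB : ‖B‖ < 1) (x : ℂ) :
    GeomOne (fun k => ∑' n, signTerm q A x B n * (q ^ n) ^ (2 * k)) ‖q ^ 2‖ := by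
  have hs := summable_norm_signTerm hq hA hB x
  have h0 : signTerm q A x B 0 = 1 := by simp [signTerm, qPoch_zero]
  refine ⟨∑' n, ‖signTerm q A x B (n + 1)‖, fun k => ?_⟩
  have h := norm_tsum_mul_pow_pow_sub_le hs hq (2 * k)
  rwa [h0, pow_mul, ← norm_pow] at h

theorem tsum_signTerm_recurrence (hq : ‖q‖ < 1) (hA : ‖A‖ < 1) (hB : ‖B‖ < 1) (x : ℂ) {Γ : ℕ → ℂ}
    (hΓ : ∀ k, Γ k = ∑' n, signTerm q A x B n * (q ^ n) ^ k) (k : ℕ) :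
    Γ k - (1 - A) * Γ (k + 1) - A * Γ (k + 2) = B * q ^ k * (Γ k - x * Γ (k + 2)) := by
  have s : ∀ j, HasSum (fun n => signTerm q A x B n * (q ^ n) ^ j) (Γ j) := fun j => by
    rw [hΓ]
    exact (summable_norm_mul_pow_pow (summable_norm_signTerm hq hA hB x) hq j).of_norm.hasSum
  have l := ((s k).sub ((s (k + 1)).mul_left (1 - A))).sub ((s (k + 2)).mul_left A)
  have r := ((s k).sub ((s (k + 2)).mul_left x)).mul_left (B * q ^ k)
  rw [← l.tsum_eq, ← r.tsum_eq]
  refine tsum_eq_tsum_of_succ l.summable (by simp; ring) fun n => ?_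
  have h := signTerm_succ hq hA x B n
  have e1 : (q ^ (n + 1)) ^ k = (q ^ n) ^ k * q ^ k := by ring
  have e2 : ∀ i, (q ^ (n + 1)) ^ (k + i) = (q ^ n) ^ k * q ^ k * (q * q ^ n) ^ i :=
    fun i => by ring
  have e3 : ∀ i, (q ^ n) ^ (k + i) = (q ^ n) ^ k * (q ^ n) ^ i := fun i => by ring
  rw [e1, e2, e2, e3]
  linear_combination (q ^ n) ^ k * q ^ k * h

theorem rogersSum_eq_sign (hq : ‖q‖ < 1) (hA : ‖A‖ < 1) (hB : ‖B‖ < 1) (hC : ‖κ * B‖ < 1) :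
    rogersSum (q ^ 2) A (A * q ^ 2) (A * q) B (κ * B) 0 0 =
      qPochInf (A * (A * q ^ 2)) (q ^ 2) / qPochInf (A * q ^ 2) (q ^ 2) *
        (qPochInf (B * q) (q ^ 2) / qPochInf (κ * B) (q ^ 2) *
        ∑' n, signTerm q A (A * κ * q) B n) := by
  have hp := norm_sq_lt_one hq
  have hz := norm_mul_lt_one_of_lt_of_lt hA hp
  have hBq := norm_mul_lt_one_of_lt_of_lt hB hq
  set Γ : ℕ → ℂ := fun k => ∑' n, signTerm q A (A * κ * q) B n * (q ^ n) ^ k with hΓ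
  set P : ℕ → ℂ := fun k => qPochInf (B * q * (q ^ 2) ^ k) (q ^ 2) *
    (qPochInf (κ * B * (q ^ 2) ^ k) (q ^ 2))⁻¹ with hP
  have hCk := fun k => qPochInf_ne_zero_of_norm_lt_one (norm_mul_pow_lt_one hC hp k) hp
  have h := rogersSum_eq_of_rogersEquation (p := q ^ 2) (A := A) (z := A * q ^ 2) (β := A * q)
    (B := B) (C := κ * B) (δ := A ^ 2) (W := fun k => P k * Γ (2 * k)) hp hz hB hC
    (norm_mul_lt_one_of_lt_of_lt hA hz) (by ring) (by ring) ?_ ?_ 0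
  · rw [h]
    simp only [hP, hΓ, mul_zero, pow_zero, mul_one, div_eq_mul_inv]
  · intro k
    have h0 := tsum_signTerm_recurrence hq hA hB (A * κ * q) (Γ := Γ) (fun _ => rfl) (2 * k)
    have h1 := tsum_signTerm_recurrence hq hA hB (A * κ * q) (Γ := Γ) (fun _ => rfl) (2 * k + 1)
    have h2 := tsum_signTerm_recurrence hq hA hB (A * κ * q) (Γ := Γ) (fun _ => rfl) (2 * k + 2)
    set S := P (k + 2) / ((1 - κ * B * (q ^ 2) ^ k) * (1 - κ * B * (q ^ 2) ^ (k + 1))) with hS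
    have n0 := one_sub_ne_zero_of_norm_lt_one (norm_mul_pow_lt_one hC hp k)
    have n1 := one_sub_ne_zero_of_norm_lt_one (norm_mul_pow_lt_one hC hp (k + 1))
    have r : ∀ j, P j * (1 - κ * B * (q ^ 2) ^ j) = P (j + 1) * (1 - B * q * (q ^ 2) ^ j) := by
      intro j
      have h1 := hCk (j + 1)
      have h2 := one_sub_ne_zero_of_norm_lt_one (norm_mul_pow_lt_one hC hp j)
      simp only [hP]
      rw [qPochInf_mul_pow (B * q) hp, qPochInf_mul_pow (κ * B) hp]
      generalize 1 - κ * B * (q ^ 2) ^ j = x1 at *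
      generalize qPochInf (κ * B * (q ^ 2) ^ (j + 1)) (q ^ 2) = x2 at *
      field_simp
    have p2 : P (k + 2) = (1 - κ * B * (q ^ 2) ^ k) * (1 - κ * B * (q ^ 2) ^ (k + 1)) * S := by
      rw [hS, mul_div_cancel₀ _ (mul_ne_zero n0 n1)]
    have p1 : P (k + 1) = (1 - κ * B * (q ^ 2) ^ k) * (1 - B * q * (q ^ 2) ^ (k + 1)) * S :=
      mul_right_cancel₀ n1 (by rw [r, p2]; ring)
    have p0 : P k = (1 - B * q * (q ^ 2) ^ k) * (1 - B * q * (q ^ 2) ^ (k + 1)) * S :=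
      mul_right_cancel₀ n0 (by rw [r, p1]; ring)
    simp only [p0, p1, p2, show 2 * (k + 1) = 2 * k + 2 by ring, show 2 * (k + 2) = 2 * k + 4 by ring]
    have e : q ^ (2 * k) = (q ^ 2) ^ k := by ring
    simp only [pow_succ (q ^ 2) k, pow_add q, e, add_assoc, Nat.reduceAdd] at h0 h1 h2 ⊢
    generalize (q ^ 2) ^ k = t at *
    clear_value S Γ
    generalize Γ (2 * k) = G0 at *
    generalize Γ (2 * k + 1) = G1 at *
    generalize Γ (2 * k + 2) = G2 at *
    generalize Γ (2 * k + 3) = G3 at *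
    generalize Γ (2 * k + 4) = G4 at *
    -- The leading operator of the one-step recurrence is (1 - T)(1 + AT). Multiplied by (1 + T)(1 -
    -- AT) = 1 + (1 - A)T - AT² it becomes (1 - T²)(1 - A²T²). The multipliers of `h0`, `h1`, `h2`
    -- are these coefficients, corrected by terms in B so that G1 and G3 cancel.
    linear_combination S * (1 - κ * B * t) * (1 - B * q * (t * q ^ 2)) *
      ((1 - t * q * B) * h0 + (1 - A) * h1 - (A - A * κ * q ^ 2 * t * B) * h2)
  · have hg := (geomOne_qPochInf (B * q) hp).mul ((geomOne_qPochInf (κ * B) hp).inv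
      (norm_nonneg _) hp hCk) (norm_nonneg _) hp
    exact hg.mul (geomOne_tsum_signTerm hq hA hB _) (norm_nonneg _) hp

end QuadraticTransformationsBaseSquared

/-! ### Euler's series for an infinite product. -/

section Euler

variable {q z : ℂ}

/-- The `n`-th term of Euler's series for `(-z;q)_∞`. -/
noncomputable def eulerTerm (q z : ℂ) (n : ℕ) : ℂ := q ^ n.choose 2 * z ^ n / qPoch q q n

theorem choose_two_succ (n : ℕ) : (n + 1).choose 2 = n.choose 2 + n := by
  rw [Nat.choose_succ_succ', Nat.choose_one_right, add_comm]

theorem eulerTerm_succ (hq : ‖q‖ < 1) (z : ℂ) (n : ℕ) :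
    eulerTerm q z (n + 1) * (1 - q * q ^ n) = eulerTerm q z n * (q ^ n * z) := by
  have h1 := one_sub_ne_zero_of_norm_lt_one (norm_mul_pow_lt_one hq hq n)
  have h2 := qPoch_ne_zero hq hq n
  simp only [eulerTerm, qPoch_succ, choose_two_succ]
  generalize 1 - q * q ^ n = x1 at *
  field_simp
  ring

theorem summable_norm_eulerTerm (hq : ‖q‖ < 1) (z : ℂ) : Summable fun n => ‖eulerTerm q z n‖ := by
  refine summable_norm_of_succ_eq_mul (l := 0 * z / (1 - 0)) (fun n => ?_)
    (((tendsto_pow_atTop_nhds_zero_of_norm_lt_one hq).mul_const z).div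
      ((tendsto_mul_pow q hq).const_sub 1) (by simp)) (by simp)
  have h1 := one_sub_ne_zero_of_norm_lt_one (norm_mul_pow_lt_one hq hq n)
  simp only [Pi.div_apply]
  rw [← mul_div_assoc, eq_div_iff h1, eulerTerm_succ hq]

/-- The functional equation f(z) = (1 + z) f(zq), iterated down to f(0) = 1. -/
theorem tsum_eulerTerm (hq : ‖q‖ < 1) (z : ℂ) : ∑' n, eulerTerm q z n = qPochInf (-z) q := by
  have hs := summable_norm_eulerTerm hq z
  set Γ : ℕ → ℂ := fun k => ∑' n, eulerTerm q z n * (q ^ n) ^ k with hΓ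
  have s : ∀ j, HasSum (fun n => eulerTerm q z n * (q ^ n) ^ j) (Γ j) := fun j =>
    (summable_norm_mul_pow_pow hs hq j).of_norm.hasSum
  have step : ∀ k, Γ k - Γ (k + 1) = z * q ^ k * Γ (k + 1) := by
    intro k
    have l := (s k).sub (s (k + 1))
    have r := (s (k + 1)).mul_left (z * q ^ k)
    rw [← l.tsum_eq, ← r.tsum_eq]
    refine tsum_eq_tsum_of_succ l.summable (by simp) fun n => ?_
    have h := eulerTerm_succ hq z n
    have e1 : (q ^ (n + 1)) ^ k = (q ^ n) ^ k * q ^ k := by ring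
    have e2 : (q ^ (n + 1)) ^ (k + 1) = (q ^ n) ^ k * q ^ k * (q * q ^ n) := by ring
    have e3 : (q ^ n) ^ (k + 1) = (q ^ n) ^ k * q ^ n := by ring
    rw [e1, e2, e3]
    linear_combination (q ^ n) ^ k * q ^ k * h
  have iter : ∀ k, Γ 0 = qPoch (-z) q k * Γ k := by
    intro k
    induction k with
    | zero => simp [qPoch_zero]
    | succ k ih => rw [ih, qPoch_succ]; linear_combination qPoch (-z) q k * step k
  have hlim := tendsto_nhds_unique tendsto_const_nhds
    (((tendsto_qPoch (-z) hq).mul (tendsto_tsum_mul_pow_pow hs hq)).congr fun k => (iter k).symm)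
  have h0 : eulerTerm q z 0 = 1 := by simp [eulerTerm, qPoch_zero]
  rw [h0, mul_one] at hlim
  rw [← hlim]
  simp [hΓ]

end Euler

/-! ### The ₂φ₂ series as a Rogers sum. -/

section EntireSeries

variable {q A B C : ℂ}

/-- The `n`-th term of `(ABCq;q²)_∞ ∑ (B, C; q)_n q^(n choose 2) A^n / ((q;q)_n (ABCq;q²)_n)`. -/
noncomputable def entireTerm (q A B C : ℂ) (n : ℕ) : ℂ :=
  qPoch B q n * qPoch C q n * eulerTerm q A n * qPochInf (A * B * C * q * (q ^ 2) ^ n) (q ^ 2)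

theorem entireTerm_succ (hq : ‖q‖ < 1) (A B C : ℂ) (n : ℕ) :
    entireTerm q A B C (n + 1) * (1 - q * q ^ n) =
      A * q ^ n * ((1 - B) * (1 - C) * entireTerm q A (B * q) (C * q) n) := by
  have e : A * B * C * q * (q ^ 2) ^ (n + 1) = A * (B * q) * (C * q) * q * (q ^ 2) ^ n := by ring
  have h := eulerTerm_succ hq A n
  simp only [entireTerm, qPoch_succ' B, qPoch_succ' C, e]
  linear_combination (1 - B) * qPoch (B * q) q n * ((1 - C) * qPoch (C * q) q n) *
    qPochInf (A * (B * q) * (C * q) * q * (q ^ 2) ^ n) (q ^ 2) * h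

/-- Passing to (Bq, Cq) multiplies ABCq by q², the base of the infinite product, so the two terms
differ only by explicit factors. -/
theorem entireTerm_shift (hq : ‖q‖ < 1) (A B C : ℂ) (n : ℕ) :
    (1 - B) * (1 - C) * entireTerm q A (B * q) (C * q) n * (1 - A * B * C * q * (q ^ n) ^ 2) =
      entireTerm q A B C n * ((1 - B * q ^ n) * (1 - C * q ^ n)) := by
  have e : A * (B * q) * (C * q) * q * (q ^ 2) ^ n = A * B * C * q * (q ^ 2) ^ (n + 1) := by ring
  have hB := (qPoch_succ' B q n).symm.trans (qPoch_succ B q n)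
  have hC := (qPoch_succ' C q n).symm.trans (qPoch_succ C q n)
  have hp := qPochInf_mul_pow (A * B * C * q) (norm_sq_lt_one hq) n
  rw [← pow_mul, mul_comm 2 n, pow_mul] at hp
  simp only [entireTerm, e]
  rw [← pow_mul q 2 n, mul_comm 2 n, pow_mul q n 2, hp]
  linear_combination (1 - C) * qPoch (C * q) q n * eulerTerm q A n *
      qPochInf (A * B * C * q * (q ^ 2) ^ (n + 1)) (q ^ 2) *
      (1 - A * B * C * q * (q ^ n) ^ 2) * hB +
    qPoch B q n * (1 - B * q ^ n) * eulerTerm q A n *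
      qPochInf (A * B * C * q * (q ^ 2) ^ (n + 1)) (q ^ 2) *
      (1 - A * B * C * q * (q ^ n) ^ 2) * hC

theorem exists_norm_entireTerm_le (hq : ‖q‖ < 1) (hA : ‖A‖ < 1) : ∃ M, ∀ B C : ℂ, ‖B‖ < 1 →
    ‖C‖ < 1 → ∀ n, ‖entireTerm q A B C n‖ ≤ ‖eulerTerm q A n‖ * M := by
  refine ⟨Real.exp (1 / (1 - ‖q‖)) * Real.exp (1 / (1 - ‖q‖)) *
    Real.exp (1 / (1 - ‖q ^ 2‖)), fun B C hB hC n => ?_⟩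
  have hp := norm_sq_lt_one hq
  have h1 := norm_qPoch_le hq hB.le n
  have h2 := norm_qPoch_le hq hC.le n
  have h3 := norm_qPochInf_le hp (norm_mul_pow_lt_one (norm_mul_lt_one_of_lt_of_lt
    (norm_mul_lt_one_of_lt_of_lt (norm_mul_lt_one_of_lt_of_lt hA hB) hC) hq) hp n).le
  simp only [entireTerm, norm_mul]
  calc _ = ‖eulerTerm q A n‖ * (‖qPoch B q n‖ * ‖qPoch C q n‖ *
        ‖qPochInf (A * B * C * q * (q ^ 2) ^ n) (q ^ 2)‖) := by ring
    _ ≤ _ := by gcongr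

theorem summable_norm_entireTerm (hq : ‖q‖ < 1) (hA : ‖A‖ < 1) (hB : ‖B‖ < 1) (hC : ‖C‖ < 1) :
    Summable fun n => ‖entireTerm q A B C n‖ := by
  obtain ⟨M, hM⟩ := exists_norm_entireTerm_le hq hA
  exact Summable.of_nonneg_of_le (fun _ => norm_nonneg _) (hM B C hB hC)
    ((summable_norm_eulerTerm hq A).mul_right M)

/-- Summing `entireTerm_shift` brings in the second moments of both the original and the shifted
series; the first relation one moment higher removes the two together, which closes the system in L
and M. -/
theorem tsum_entireTerm_step (hq : ‖q‖ < 1) (hA : ‖A‖ < 1) (hB : ‖B‖ < 1) (hC : ‖C‖ < 1)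
    {L M : ℂ → ℂ → ℂ} (hL : ∀ B C, L B C = ∑' n, entireTerm q A B C n)
    (hM : ∀ B C, M B C = ∑' n, entireTerm q A B C n * q ^ n) :
    A * ((1 - B) * (1 - C)) * M (B * q) (C * q) = L B C - M B C ∧
    (1 - B) * (1 - C) * L (B * q) (C * q) = L B C - (B + C - B * C) * M B C := by
  have hs := summable_norm_entireTerm hq hA hB hC
  have hs' := summable_norm_entireTerm hq hA (norm_mul_lt_one_of_lt_of_lt hB hq)
    (norm_mul_lt_one_of_lt_of_lt hC hq)
  set X : ℕ → ℂ := fun j => ∑' n, entireTerm q A B C n * (q ^ n) ^ j with hX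
  set Y : ℕ → ℂ := fun j => ∑' n, entireTerm q A (B * q) (C * q) n * (q ^ n) ^ j with hY
  have s : ∀ j, HasSum (fun n => entireTerm q A B C n * (q ^ n) ^ j) (X j) := fun j =>
    (summable_norm_mul_pow_pow hs hq j).of_norm.hasSum
  have s' : ∀ j, HasSum (fun n => entireTerm q A (B * q) (C * q) n * (q ^ n) ^ j) (Y j) :=
    fun j => (summable_norm_mul_pow_pow hs' hq j).of_norm.hasSum
  have hLX : L B C = X 0 := by simp [hL, hX]
  have hMX : M B C = X 1 := by simp [hM, hX]
  have hLY : L (B * q) (C * q) = Y 0 := by simp [hL, hY]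
  have hMY : M (B * q) (C * q) = Y 1 := by simp [hM, hY]
  have h1 : ∀ j, X j - X (j + 1) = A * ((1 - B) * (1 - C)) * q ^ j * Y (j + 1) := by
    intro j
    have l := (s j).sub (s (j + 1))
    have r := (s' (j + 1)).mul_left (A * ((1 - B) * (1 - C)) * q ^ j)
    rw [← l.tsum_eq, ← r.tsum_eq]
    refine tsum_eq_tsum_of_succ l.summable (by simp) fun n => ?_
    have h := entireTerm_succ hq A B C n
    have e1 : (q ^ (n + 1)) ^ j = (q ^ n) ^ j * q ^ j := by ring
    have e2 : (q ^ (n + 1)) ^ (j + 1) = (q ^ n) ^ j * q ^ j * (q * q ^ n) := by ring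
    have e3 : (q ^ n) ^ (j + 1) = (q ^ n) ^ j * q ^ n := by ring
    rw [e1, e2, e3]
    linear_combination (q ^ n) ^ j * q ^ j * h
  have h2 : (1 - B) * (1 - C) * (Y 0 - A * B * C * q * Y 2) =
      X 0 - (B + C) * X 1 + B * C * X 2 := by
    have l := ((s' 0).sub ((s' 2).mul_left (A * B * C * q))).mul_left ((1 - B) * (1 - C))
    have r := ((s 0).sub ((s 1).mul_left (B + C))).add ((s 2).mul_left (B * C))
    rw [← l.tsum_eq, ← r.tsum_eq]
    refine tsum_congr fun n => ?_
    linear_combination entireTerm_shift hq A B C n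
  have h10 := h1 0
  have h11 := h1 1
  simp only [zero_add, Nat.reduceAdd, pow_zero, pow_one, mul_one] at h10 h11
  rw [hLX, hMX, hLY, hMY]
  exact ⟨by linear_combination -h10, by linear_combination h2 - B * C * h11⟩

/-- Dominated convergence: as B and C shrink to 0 only Euler's series at Aq remains. -/
theorem tendsto_tsum_entireTerm (hq : ‖q‖ < 1) (hA : ‖A‖ < 1) (hB : ‖B‖ < 1) (hC : ‖C‖ < 1) :
    Tendsto (fun k : ℕ => ∑' n, entireTerm q A (B * q ^ k) (C * q ^ k) n * q ^ n) atTop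
      (𝓝 (qPochInf (-(A * q)) q)) := by
  have e : qPochInf (-(A * q)) q = ∑' n, eulerTerm q A n * q ^ n := by
    rw [← tsum_eulerTerm hq]
    refine tsum_congr fun n => ?_
    simp only [eulerTerm, mul_pow]
    ring
  obtain ⟨M, hM⟩ := exists_norm_entireTerm_le hq hA
  rw [e]
  refine tendsto_tsum_of_dominated_convergence (bound := fun n => ‖eulerTerm q A n‖ * M)
    ((summable_norm_eulerTerm hq A).mul_right M) (fun n => ?_)
    (Eventually.of_forall fun k n => ?_)
  · have hpoch : ∀ x : ℂ, Tendsto (fun k : ℕ => qPoch (x * q ^ k) q n) atTop (𝓝 1) := by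
      intro x
      have hc : Continuous fun y : ℂ => qPoch y q n := by unfold qPoch; fun_prop
      have := (hc.tendsto 0).comp (tendsto_mul_pow x hq)
      simpa only [qPoch_zero_left, Function.comp_def] using this
    have hinf : Tendsto (fun k : ℕ => qPochInf (A * (B * q ^ k) * (C * q ^ k) * q * (q ^ 2) ^ n)
        (q ^ 2)) atTop (𝓝 1) := by
      refine (tendsto_qPochInf_nhds_zero (norm_sq_lt_one hq)).comp ?_
      have hc : Continuous fun y : ℂ × ℂ => A * y.1 * y.2 * q * (q ^ 2) ^ n := by fun_prop
      have := (hc.tendsto (0, 0)).comp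
        ((tendsto_mul_pow B hq).prodMk_nhds (tendsto_mul_pow C hq))
      simpa only [mul_zero, zero_mul, Function.comp_def] using this
    have := ((((hpoch B).mul (hpoch C)).mul_const (eulerTerm q A n)).mul hinf).mul_const (q ^ n)
    simpa only [one_mul, mul_one, entireTerm] using this
  · rw [norm_mul]
    refine (mul_le_of_le_one_right (norm_nonneg _) (norm_pow_le_one hq n)).trans ?_
    exact hM _ _ (norm_mul_pow_lt_one hB hq k) (norm_mul_pow_lt_one hC hq k) n

/-- Two shifts (B, C) → (Bq, Cq) make one step in base q². After division by U, the pair (L, M)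
obeys the first order system of the Rogers moments j = 0, 1. Eliminating the moment 0 gives the
Rogers equation for the moment 1 with Aq² in place of z = A, in accordance with (Aq)² = A · Aq².
Here δ = A², so |δ| < 1 and boundedness (ρ = 1) suffices for uniqueness. -/
theorem tsum_entireTerm_eq_rogersSum (hq : ‖q‖ < 1) (hA : ‖A‖ < 1) (hB : ‖B‖ < 1)
    (hC : ‖C‖ < 1) :
    ∑' n, entireTerm q A B C n = qPochInf (-A) q * qPochInf A (q ^ 2) / qPochInf (A ^ 2) (q ^ 2) *
      (qPochInf B (q ^ 2) * qPochInf C (q ^ 2)) *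
      rogersSum (q ^ 2) A A (A * q) B C 0 0 := by
  have hp := norm_sq_lt_one hq
  have hz := norm_mul_lt_one_of_lt_of_lt hA hp
  have hAA := norm_sq_lt_one hA
  set L : ℂ → ℂ → ℂ := fun B C => ∑' n, entireTerm q A B C n with hL
  set M : ℂ → ℂ → ℂ := fun B C => ∑' n, entireTerm q A B C n * q ^ n with hM
  set U : ℕ → ℂ := fun k => qPochInf (B * (q ^ 2) ^ k) (q ^ 2) * qPochInf (C * (q ^ 2) ^ k) (q ^ 2)
    with hU
  have hU0 : ∀ k, U k ≠ 0 := fun k => mul_ne_zero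
    (qPochInf_ne_zero_of_norm_lt_one (norm_mul_pow_lt_one hB hp k) hp)
    (qPochInf_ne_zero_of_norm_lt_one (norm_mul_pow_lt_one hC hp k) hp)
  set F : ℕ → ℂ := fun k => L (B * (q ^ 2) ^ k) (C * (q ^ 2) ^ k) / U k with hF
  set K : ℕ → ℂ := fun k => M (B * (q ^ 2) ^ k) (C * (q ^ 2) ^ k) / U k with hK
  have sys : ∀ k, (K k - A ^ 2 * K (k + 1) = F k - A * F (k + 1)) ∧
      (F k - F (k + 1) = (q ^ 2) ^ k * (B + C) * (K k - A * q * K (k + 1)) -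
        ((q ^ 2) ^ k) ^ 2 * (B * C) * (K k - A * q ^ 2 * K (k + 1))) := by
    intro k
    have hb := norm_mul_pow_lt_one hB hp k
    have hc := norm_mul_pow_lt_one hC hp k
    obtain ⟨m0, l0⟩ := tsum_entireTerm_step hq hA hb hc (L := L) (M := M) (fun _ _ => rfl)
      fun _ _ => rfl
    obtain ⟨m1, l1⟩ := tsum_entireTerm_step hq hA (norm_mul_lt_one_of_lt_of_lt hb hq)
      (norm_mul_lt_one_of_lt_of_lt hc hq) (L := L) (M := M) (fun _ _ => rfl) fun _ _ => rfl
    have w0 := mul_ne_zero (one_sub_ne_zero_of_norm_lt_one hb) (one_sub_ne_zero_of_norm_lt_one hc)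
    have w1 := mul_ne_zero
      (one_sub_ne_zero_of_norm_lt_one (norm_mul_lt_one_of_lt_of_lt hb hq))
      (one_sub_ne_zero_of_norm_lt_one (norm_mul_lt_one_of_lt_of_lt hc hq))
    have u : U k = (1 - B * (q ^ 2) ^ k) * (1 - C * (q ^ 2) ^ k) * U (k + 1) := by
      simp only [hU]
      rw [qPochInf_mul_pow B hp, qPochInf_mul_pow C hp]
      ring
    have hU1 := hU0 (k + 1)
    have eB : B * (q ^ 2) ^ (k + 1) = B * (q ^ 2) ^ k * q * q := by ring
    have eC : C * (q ^ 2) ^ (k + 1) = C * (q ^ 2) ^ k * q * q := by ring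
    simp only [hF, hK, eB, eC, u]
    clear_value L M U
    generalize L (B * (q ^ 2) ^ k * q * q) (C * (q ^ 2) ^ k * q * q) = L2 at *
    generalize M (B * (q ^ 2) ^ k * q * q) (C * (q ^ 2) ^ k * q * q) = M2 at *
    generalize L (B * (q ^ 2) ^ k * q) (C * (q ^ 2) ^ k * q) = L1 at *
    generalize M (B * (q ^ 2) ^ k * q) (C * (q ^ 2) ^ k * q) = M1 at *
    generalize L (B * (q ^ 2) ^ k) (C * (q ^ 2) ^ k) = L0 at *
    generalize M (B * (q ^ 2) ^ k) (C * (q ^ 2) ^ k) = M0 at *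
    generalize U (k + 1) = V at *
    have hL2 : ∀ x : ℂ, x / V = (1 - B * (q ^ 2) ^ k) * (1 - C * (q ^ 2) ^ k) * x /
        ((1 - B * (q ^ 2) ^ k) * (1 - C * (q ^ 2) ^ k) * V) := fun x => by
      rw [mul_div_mul_left _ _ w0]
    rw [hL2 L2, hL2 M2]
    generalize (q ^ 2) ^ k = t at *
    -- `s1` and `s2` eliminate the intermediate values L1, M1 between the two q-shifts.
    have s1 : M0 - A ^ 2 * ((1 - B * t) * (1 - C * t) * M2) =
        L0 - A * ((1 - B * t) * (1 - C * t) * L2) :=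
      mul_left_cancel₀ w1 (by
        linear_combination (-A * (1 - B * t) * (1 - C * t)) * m1 +
          A * (1 - B * t) * (1 - C * t) * l1 + (1 - B * t * q) * (1 - C * t * q) * m0)
    have s2 : L0 - (1 - B * t) * (1 - C * t) * L2 =
        t * (B + C) * (M0 - A * q * ((1 - B * t) * (1 - C * t) * M2)) -
        t ^ 2 * (B * C) * (M0 - A * q ^ 2 * ((1 - B * t) * (1 - C * t) * M2)) :=
      mul_left_cancel₀ w1 (by
        linear_combination (1 - B * t) * (1 - C * t) *
            (1 - (1 - B * t * q) * (1 - C * t * q)) * m1 -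
          (1 - B * t) * (1 - C * t) * l1 - (1 - B * t * q) * (1 - C * t * q) * l0)
    constructor
    · linear_combination ((1 - B * t) * (1 - C * t) * V)⁻¹ * s1
    · linear_combination ((1 - B * t) * (1 - C * t) * V)⁻¹ * s2
  set F' := rogersSum (q ^ 2) A A (A * q) B C 0 with hF'
  set K' := rogersSum (q ^ 2) A A (A * q) B C 1 with hK'
  have sys' : ∀ k, (K' k - A ^ 2 * K' (k + 1) = F' k - A * F' (k + 1)) ∧
      (F' k - F' (k + 1) = (q ^ 2) ^ k * (B + C) * (K' k - A * q * K' (k + 1)) -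
        ((q ^ 2) ^ k) ^ 2 * (B * C) * (K' k - A * q ^ 2 * K' (k + 1))) := by
    intro k
    have w0 := rogersSum_weight (A := A) (β := A * q) hp hA hB hC 0 k
    have w1 := rogersSum_weight (A := A) (β := A * q) hp hA hB hC 1 k
    have e := rogersSum_shift (A := A) (β := A * q) hp hA hB hC 0 k
    simp only [zero_add, pow_zero, pow_one, mul_one, Nat.reduceAdd] at w0 w1 e
    exact ⟨by linear_combination w0, by linear_combination e - ((q ^ 2) ^ k) ^ 2 * (B * C) * w1⟩
  have eqn : ∀ F K : ℕ → ℂ, (∀ k, (K k - A ^ 2 * K (k + 1) = F k - A * F (k + 1)) ∧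
      (F k - F (k + 1) = (q ^ 2) ^ k * (B + C) * (K k - A * q * K (k + 1)) -
        ((q ^ 2) ^ k) ^ 2 * (B * C) * (K k - A * q ^ 2 * K (k + 1)))) →
      RogersEquation (q ^ 2) (A ^ 2) (A * q ^ 2) (A * q) B C K := by
    intro F K h k
    linear_combination (h k).1 - (h (k + 1)).1 + (h k).2 - A * (h (k + 1)).2
  have hUlim : Tendsto U atTop (𝓝 1) := by
    have := (tendsto_qPochInf_mul_pow B hp).mul (tendsto_qPochInf_mul_pow C hp)
    simpa only [mul_one] using this
  have hKlim : Tendsto K atTop (𝓝 (qPochInf (-(A * q)) q)) := by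
    have h := (tendsto_tsum_entireTerm hq hA hB hC).comp (tendsto_id.const_mul_atTop' two_pos)
    have := h.div hUlim one_ne_zero
    simp only [div_one] at this
    refine this.congr fun k => ?_
    simp only [Pi.div_apply, Function.comp_apply, id, hK, hM, pow_mul]
  have hK'lim : Tendsto K' atTop (𝓝 (qPochInf (A * (A * q ^ 2)) (q ^ 2) /
      qPochInf (A * q ^ 2) (q ^ 2))) := by
    have h := tendsto_rogersSum hp hA hB hC A (A * q) 1
    rwa [← tsum_qBinomTerm hp hz, tsum_congr fun n => (show qBinomTerm A (q ^ 2) (A * q ^ 2) n =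
      qBinomTerm A (q ^ 2) A n * ((q ^ 2) ^ n) ^ 1 by
        simpa using qBinomTerm_mul_pow A (q ^ 2) A (q ^ 2) n 1)]
  have hd1 : qPochInf (A * (A * q ^ 2)) (q ^ 2) ≠ 0 :=
    qPochInf_ne_zero_of_norm_lt_one (norm_mul_lt_one_of_lt_of_lt hA hz) hp
  have hd2 : qPochInf (A * q ^ 2) (q ^ 2) ≠ 0 := qPochInf_ne_zero_of_norm_lt_one hz hp
  set c : ℂ := qPochInf (-(A * q)) q * qPochInf (A * q ^ 2) (q ^ 2) /
    qPochInf (A * (A * q ^ 2)) (q ^ 2) with hc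
  have hlim : Tendsto (fun k => K k - c * K' k) atTop (𝓝 0) := by
    have h := hKlim.sub (hK'lim.const_mul c)
    have e : qPochInf (-(A * q)) q - c * (qPochInf (A * (A * q ^ 2)) (q ^ 2) /
        qPochInf (A * q ^ 2) (q ^ 2)) = 0 := by
      rw [hc]
      generalize qPochInf (A * (A * q ^ 2)) (q ^ 2) = y at hd1 ⊢
      generalize qPochInf (A * q ^ 2) (q ^ 2) = y' at hd2 ⊢
      field_simp
      ring
    rwa [e] at h
  obtain ⟨D, hD⟩ := exists_norm_le_of_tendsto hlim
  have hKK : ∀ k, K k = c * K' k := rogersEquation_unique hp hB hC zero_le_one le_rfl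
    (by simpa using hA) (eqn F K sys) ((eqn F' K' sys').const_mul c) (by simpa using hD) hlim
  have hFF : F 0 = c * F' 0 := by
    obtain ⟨a1, a2⟩ := sys 0
    obtain ⟨b1, b2⟩ := sys' 0
    rw [hKK, hKK] at a1 a2
    -- (F 0 - A F 1) - A (F 0 - F 1) = (1 - A) F 0, so the system recovers F 0 from K 0 and K 1.
    refine mul_left_cancel₀ (one_sub_ne_zero_of_norm_lt_one hA) ?_
    linear_combination -a1 + c * b1 - A * a2 + A * c * b2
  have hU00 : U 0 = qPochInf B (q ^ 2) * qPochInf C (q ^ 2) := by simp [hU]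
  have hFL : L B C = U 0 * F 0 := by
    rw [hF]
    simp only [pow_zero, mul_one]
    rw [mul_div_cancel₀ _ (hU0 0)]
  have hnA : 1 - A ^ 2 ≠ 0 := one_sub_ne_zero_of_norm_lt_one hAA
  have hcc : c = qPochInf (-A) q * qPochInf A (q ^ 2) / qPochInf (A ^ 2) (q ^ 2) := by
    rw [hc, qPochInf_eq_mul (-A) hq, qPochInf_eq_mul A hp, qPochInf_eq_mul (A ^ 2) hp,
      show A ^ 2 * q ^ 2 = A * (A * q ^ 2) by ring, neg_mul, div_eq_div_iff hd1
      (mul_ne_zero hnA hd1)]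
    ring
  change L B C = _
  rw [hFL, hFF, hU00, hcc]
  ring

end EntireSeries

/-! ### The cubic evaluation of Rogers sums. -/

section Cubic

variable {p q A z β ω : ℂ}

theorem norm_pow_lt_one' (hq : ‖q‖ < 1) {n : ℕ} (hn : n ≠ 0) : ‖q ^ n‖ < 1 := by
  rw [norm_pow]; exact pow_lt_one₀ (norm_nonneg _) hq hn

theorem IsPrimitiveRoot.norm_three (hω : IsPrimitiveRoot ω 3) : ‖ω‖ = 1 :=
  hω.norm'_eq_one three_ne_zero

/-- `qPochInf_cubic` at x = βAp^m and at x = Ap^m: the factor at x itself is absent from the ratio,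
and dividing it out leaves the finite products. -/
theorem rogersRatio_cubic (hω : IsPrimitiveRoot ω 3) (hp : ‖p‖ < 1) (hA : ‖A‖ < 1)
    (hβA : ‖β * A‖ < 1) (m : ℕ) :
    rogersRatio p β (A * ω) (A * ω ^ 2) m =
      qPochInf A p / qPochInf (β * A) p * (qPoch (β * A) p m / qPoch A p m) *
        (qPochInf (β ^ 3 * A ^ 3 * (p ^ 3) ^ m) (p ^ 3) /
          qPochInf (A ^ 3 * (p ^ 3) ^ m) (p ^ 3)) := by
  have hω1 := hω.norm_three
  have hAω : ‖A * ω‖ < 1 := by rwa [norm_mul, hω1, mul_one]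
  have hAω2 : ‖A * ω ^ 2‖ < 1 := by rwa [norm_mul, norm_pow, hω1, one_pow, mul_one]
  have c1 := qPochInf_cubic hω (β * A * p ^ m) hp
  have c2 := qPochInf_cubic hω (A * p ^ m) hp
  have s1 := qPochInf_eq_qPoch_mul (β * A) hp m
  have s2 := qPochInf_eq_qPoch_mul A hp m
  have n1 := qPochInf_ne_zero_of_norm_lt_one (norm_mul_pow_lt_one hβA hp m) hp
  have n2 := qPochInf_ne_zero_of_norm_lt_one (norm_mul_pow_lt_one hA hp m) hp
  have n3 := qPochInf_ne_zero_of_norm_lt_one (norm_mul_pow_lt_one hAω hp m) hp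
  have n4 := qPochInf_ne_zero_of_norm_lt_one (norm_mul_pow_lt_one hAω2 hp m) hp
  have n5 := qPoch_ne_zero hβA hp m
  have n6 := qPoch_ne_zero hA hp m
  rw [show β ^ 3 * A ^ 3 * (p ^ 3) ^ m = (β * A * p ^ m) ^ 3 by ring,
    show A ^ 3 * (p ^ 3) ^ m = (A * p ^ m) ^ 3 by ring, ← c1, ← c2, s1, s2]
  simp only [rogersRatio, show β * (A * ω) * p ^ m = β * A * p ^ m * ω by ring,
    show β * (A * ω ^ 2) * p ^ m = β * A * p ^ m * ω ^ 2 by ring,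
    show A * ω * p ^ m = A * p ^ m * ω by ring,
    show A * ω ^ 2 * p ^ m = A * p ^ m * ω ^ 2 by ring] at n3 n4 ⊢
  generalize qPochInf (β * A * p ^ m) p = x1 at *
  generalize qPochInf (A * p ^ m) p = x2 at *
  generalize qPochInf (A * p ^ m * ω) p = x3 at *
  generalize qPochInf (A * p ^ m * ω ^ 2) p = x4 at *
  generalize qPoch (β * A) p m = x5 at *
  generalize qPoch A p m = x6 at *
  field_simp

/-- The cubic series `∑ (b;p³)_n (z;p)_{3n} / ((p³;p³)_n (y;p)_{3n}) Z^n`. -/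
noncomputable def cubicSum (p b z y Z : ℂ) : ℂ :=
  ∑' n, qBinomTerm b (p ^ 3) Z n * (qPoch z p (3 * n) / qPoch y p (3 * n))

/-- Bibasic Heine with bases p³ and p: the shift by (p³)^n is one by p^(3n), hence the index 3n in
base p. -/
theorem tsum_cubic_heine (hp : ‖p‖ < 1) (hA : ‖A‖ < 1) (hz : ‖z‖ < 1) (hβA : ‖β * A‖ < 1) :
    ∑' m, qBinomTerm (β * A) p z m * (qPochInf (β ^ 3 * A ^ 3 * (p ^ 3) ^ m) (p ^ 3) /
        qPochInf (A ^ 3 * (p ^ 3) ^ m) (p ^ 3)) =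
      qPochInf (β * A * z) p / qPochInf z p *
        cubicSum p (β ^ 3) z (β * A * z) (A ^ 3) := by
  have hy := norm_mul_lt_one_of_lt_of_lt hβA hz
  rw [← tsum_bibasic_heine (norm_pow_lt_one' hp three_ne_zero) hp
    (norm_pow_lt_one' hA three_ne_zero) hz, cubicSum, ← tsum_mul_left]
  refine tsum_congr fun n => ?_
  have e : (p ^ 3) ^ n = p ^ (3 * n) := by ring
  have n1 := qPochInf_ne_zero_of_norm_lt_one (norm_mul_pow_lt_one hz hp (3 * n)) hp
  have n2 := qPoch_ne_zero hz hp (3 * n)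
  have n3 := qPoch_ne_zero hy hp (3 * n)
  rw [e, qPochInf_eq_qPoch_mul (β * A * z) hp (3 * n), qPochInf_eq_qPoch_mul z hp (3 * n)]
  generalize qPochInf (z * p ^ (3 * n)) p = x1 at *
  generalize qPochInf (β * A * z * p ^ (3 * n)) p = x2 at *
  generalize qPoch z p (3 * n) = x3 at *
  generalize qPoch (β * A * z) p (3 * n) = x4 at *
  field_simp

theorem rogersSum_cubic (hω : IsPrimitiveRoot ω 3) (hp : ‖p‖ < 1) (hA : ‖A‖ < 1) (hz : ‖z‖ < 1)
    (hβA : ‖β * A‖ < 1) :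
    rogersSum p A z β (A * ω) (A * ω ^ 2) 0 0 =
      qPochInf A p / qPochInf (β * A) p * (qPochInf (β * A * z) p / qPochInf z p *
        cubicSum p (β ^ 3) z (β * A * z) (A ^ 3)) := by
  rw [← tsum_cubic_heine hp hA hz hβA, rogersSum, ← tsum_mul_left]
  refine tsum_congr fun m => ?_
  have n6 := qPoch_ne_zero hA hp m
  rw [add_zero, rogersRatio_cubic hω hp hA hβA]
  simp only [qBinomTerm, pow_zero, mul_one]
  generalize qPoch A p m = x6 at *
  field_simp

theorem summable_cubic_heine (hp : ‖p‖ < 1) (hz : ‖z‖ < 1) (e : ℂ) :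
    Summable fun m => qBinomTerm e p z m * (qPochInf (β ^ 3 * A ^ 3 * (p ^ 3) ^ m) (p ^ 3) /
        qPochInf (A ^ 3 * (p ^ 3) ^ m) (p ^ 3)) := by
  have hp3 := norm_pow_lt_one' hp three_ne_zero
  obtain ⟨D, hD⟩ := exists_norm_le_of_tendsto ((tendsto_qPochInf_mul_pow (β ^ 3 * A ^ 3) hp3).div
    (tendsto_qPochInf_mul_pow (A ^ 3) hp3) one_ne_zero)
  exact (summable_norm_mul_of_bounded (summable_norm_qBinomTerm hp hz e) hD).of_norm

/-- (Ap; p)_m = (A; p)_m (1 - Ap^m) / (1 - A), so cancelling (A; p)_m leaves 1 - Ap^m; its second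
term moves the argument from Ap to Ap². -/
theorem rogersSum_cubic_shifted (hω : IsPrimitiveRoot ω 3) (hp : ‖p‖ < 1) (hA : ‖A‖ < 1)
    (hβA : ‖β * A‖ < 1) :
    rogersSum p (A * p) (A * p) β (A * ω) (A * ω ^ 2) 0 0 =
      qPochInf (A * p) p / qPochInf (β * A) p *
        (qPochInf (β * A * (A * p)) p / qPochInf (A * p) p *
          cubicSum p (β ^ 3) (A * p) (β * A * (A * p)) (A ^ 3) -
        A * (qPochInf (β * A * (A * p * p)) p / qPochInf (A * p * p) p *
          cubicSum p (β ^ 3) (A * p * p) (β * A * (A * p * p)) (A ^ 3))) := by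
  have hz := norm_mul_lt_one_of_lt_of_lt hA hp
  have hz2 := norm_mul_lt_one_of_lt_of_lt hz hp
  rw [← tsum_cubic_heine hp hA hz hβA, ← tsum_cubic_heine hp hA hz2 hβA, rogersSum,
    ← tsum_mul_left, ← (summable_cubic_heine hp hz _).tsum_sub
      ((summable_cubic_heine hp hz2 _).mul_left A), ← tsum_mul_left]
  refine tsum_congr fun m => ?_
  have n6 := qPoch_ne_zero hA hp m
  have n1 := one_sub_ne_zero_of_norm_lt_one hA
  have h := (qPoch_succ' A p m).symm.trans (qPoch_succ A p m)
  have h' : qPoch (A * p) p m = qPoch A p m * (1 - A * p ^ m) / (1 - A) := by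
    rw [eq_div_iff n1, ← h, mul_comm]
  rw [add_zero, rogersRatio_cubic hω hp hA hβA, qPochInf_eq_mul A hp]
  simp only [qBinomTerm, pow_zero, mul_one, h', mul_pow]
  generalize qPoch A p m = x6 at *
  field_simp

end Cubic

/-! ### Terms of basic hypergeometric series, and termination forced by convergence. -/

section PhiTerm

theorem phiTerm_two_one (x₁ x₂ y q z : ℂ) (n : ℕ) :
    phiTerm [x₁, x₂] [y] q z n =
      qPoch x₁ q n * qPoch x₂ q n / (qPoch q q n * qPoch y q n) * z ^ n := by
  simp [phiTerm]

theorem phiTerm_three_two (x₁ x₂ x₃ y₁ y₂ q z : ℂ) (n : ℕ) :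
    phiTerm [x₁, x₂, x₃] [y₁, y₂] q z n = qPoch x₁ q n * qPoch x₂ q n * qPoch x₃ q n /
      (qPoch q q n * (qPoch y₁ q n * qPoch y₂ q n)) * z ^ n := by
  simp [phiTerm, mul_assoc]

theorem phiTerm_two_two (x₁ x₂ y₁ y₂ q z : ℂ) (n : ℕ) :
    phiTerm [x₁, x₂] [y₁, y₂] q z n = qPoch x₁ q n * qPoch x₂ q n /
      (qPoch q q n * (qPoch y₁ q n * qPoch y₂ q n)) * (q ^ n.choose 2 * (-z) ^ n) := by
  simp only [phiTerm, List.map_cons, List.map_nil, List.prod_cons, List.prod_nil, mul_one,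
    List.length_cons, List.length_nil, neg_pow z]
  norm_num
  ring

/-- The terms tend to 0 and the denominators converge; as |z| ≥ 1, the numerators tend to 0. Their
limit is the product of the (a; q)_∞, so one of these vanishes. -/
theorem exists_mul_pow_eq_one_of_phiConverges {as bs : List ℂ} {q z : ℂ} (hq : ‖q‖ < 1)
    (hlen : as.length = bs.length + 1) (hz : 1 ≤ ‖z‖) (h : PhiConverges as bs q z) :
    ∃ a ∈ as, ∃ n : ℕ, a * q ^ n = 1 := by
  by_contra! hcon
  obtain ⟨hb, s, hs⟩ := h
  have hnum : Tendsto (fun n => (as.map fun a => qPoch a q n).prod) atTop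
      (𝓝 (as.map fun a => qPochInf a q).prod) :=
    tendsto_list_prod as fun a _ => tendsto_qPoch a hq
  have hden : Tendsto (fun n => qPoch q q n * (bs.map fun b => qPoch b q n).prod) atTop
      (𝓝 (qPochInf q q * (bs.map fun b => qPochInf b q).prod)) :=
    (tendsto_qPoch q hq).mul (tendsto_list_prod bs fun b _ => tendsto_qPoch b hq)
  have hden0 : ∀ n, qPoch q q n * (bs.map fun b => qPoch b q n).prod ≠ 0 := by
    intro n
    refine mul_ne_zero (qPoch_ne_zero hq hq n) ?_
    refine List.prod_ne_zero fun h0 => ?_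
    obtain ⟨b, hbs, hb0⟩ := List.mem_map.mp h0
    exact hb b hbs n hb0
  have hterm : Tendsto (phiTerm as bs q z) atTop (𝓝 0) := by
    have := (hs.comp (tendsto_add_atTop_nat 1)).sub hs
    rw [sub_self] at this
    refine this.congr fun n => ?_
    simp [Finset.sum_range_succ]
  have hzero : Tendsto (fun n => ‖(as.map fun a => qPoch a q n).prod‖) atTop (𝓝 0) := by
    have hprod := (hterm.mul hden).norm
    rw [zero_mul, norm_zero] at hprod
    refine squeeze_zero (fun _ => norm_nonneg _) (fun n => ?_) hprod
    have e : phiTerm as bs q z n * (qPoch q q n * (bs.map fun b => qPoch b q n).prod) =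
        (as.map fun a => qPoch a q n).prod * z ^ n := by
      have h0 : 1 + (bs.length : ℤ) - (as.length : ℤ) = 0 := by rw [hlen]; push_cast; ring
      rw [phiTerm, h0, zpow_zero, mul_one, mul_right_comm, div_mul_cancel₀ _ (hden0 n)]
    rw [e, norm_mul, norm_pow]
    exact le_mul_of_one_le_right (norm_nonneg _) (one_le_pow₀ hz)
  have h0 := tendsto_nhds_unique hnum.norm hzero
  rw [norm_eq_zero, List.prod_eq_zero_iff] at h0
  obtain ⟨a, ha, ha0⟩ := List.mem_map.mp h0
  exact qPochInf_ne_zero hq (fun j => sub_ne_zero.mpr (hcon a ha j).symm) ha0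

end PhiTerm

/-! ### Cubic sums as ₃φ₂ series. -/

section CubicPhi

variable {p z y Z : ℂ}

/-- (y; p)_(3n) splits into products in base p³ at y, yp and yp². This lemma and the next two treat
the case where the numerator parameter cancels the first, second or third of them. -/
theorem cubicSum_eq_phi (hp : ‖p‖ < 1) (hy : ‖y‖ < 1) (z Z : ℂ) :
    cubicSum p y z y Z = phi [z, z * p, z * p ^ 2] [y * p, y * p ^ 2] (p ^ 3) Z := by
  refine tsum_congr fun n => ?_
  have h := qPoch_ne_zero hy (norm_pow_lt_one' hp three_ne_zero) n
  rw [phiTerm_three_two, qBinomTerm, qPoch_three_mul z, qPoch_three_mul y]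
  generalize qPoch y (p ^ 3) n = x at *
  field_simp

theorem cubicSum_eq_phi_mul (hp : ‖p‖ < 1) (hy : ‖y‖ < 1) (z Z : ℂ) :
    cubicSum p (y * p) z y Z = phi [z, z * p, z * p ^ 2] [y, y * p ^ 2] (p ^ 3) Z := by
  refine tsum_congr fun n => ?_
  have h := qPoch_ne_zero (norm_mul_lt_one_of_lt_of_lt hy hp) (norm_pow_lt_one' hp three_ne_zero) n
  rw [phiTerm_three_two, qBinomTerm, qPoch_three_mul z, qPoch_three_mul y]
  generalize qPoch (y * p) (p ^ 3) n = x at *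
  field_simp

theorem cubicSum_eq_phi_mul_sq (hp : ‖p‖ < 1) (hy : ‖y‖ < 1) (z Z : ℂ) :
    cubicSum p (y * p ^ 2) z y Z = phi [z, z * p, z * p ^ 2] [y, y * p] (p ^ 3) Z := by
  refine tsum_congr fun n => ?_
  have h := qPoch_ne_zero (norm_mul_pow_lt_one hy hp 2) (norm_pow_lt_one' hp three_ne_zero) n
  rw [phiTerm_three_two, qBinomTerm, qPoch_three_mul z, qPoch_three_mul y]
  generalize qPoch (y * p ^ 2) (p ^ 3) n = x at *
  field_simp

end CubicPhi

/-! ### Comparison of the two evaluations, for |A| < 1. -/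

section Core

variable {q A ω : ℂ}

/-- The cubic side is used with the primitive root ω², so that B = Aω² and C = Aω⁴ = Aω. -/
theorem tsum_signTerm_cubic (hω : IsPrimitiveRoot ω 3) (hq : ‖q‖ < 1) (hA : ‖A‖ < 1) :
    ∑' n, signTerm q A (A * ω ^ 2 * q) (A * ω ^ 2) n =
      qPochInf (A ^ 3 * q ^ 3) (q ^ 2) * qPochInf (A ^ 3) (q ^ 6) /
        (qPochInf (A * ω ^ 2) q * qPochInf (A ^ 2 * q) q) *
      phi [A * q ^ 2, A * q ^ 4, A * q ^ 6] [A ^ 3 * q ^ 5, A ^ 3 * q ^ 7] (q ^ 6) (A ^ 3) := by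
  have hp := norm_sq_lt_one hq
  have hω3 : ω ^ 3 = 1 := hω.pow_eq_one
  have hω2 : IsPrimitiveRoot (ω ^ 2) 3 := hω.pow_of_coprime 2 (by norm_num)
  have hω1 := hω.norm_three
  have hB : ‖A * ω ^ 2‖ < 1 := by rwa [norm_mul, norm_pow, hω1, one_pow, mul_one]
  have eC : ω ^ 2 * (A * ω ^ 2) = A * ω := by linear_combination A * ω * hω3
  have eC' : A * (ω ^ 2) ^ 2 = A * ω := by linear_combination A * ω * hω3
  have hC : ‖A * ω‖ < 1 := by rwa [norm_mul, hω1, mul_one]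
  have hz := norm_mul_lt_one_of_lt_of_lt hA hp
  have hβ := norm_mul_lt_one_of_lt_of_lt (norm_mul_lt_one_of_lt_of_lt hA hq) hA
  have hy : ‖A ^ 3 * q ^ 3‖ < 1 := norm_mul_lt_one_of_lt_of_lt
    (norm_pow_lt_one' hA three_ne_zero) (norm_pow_lt_one' hq three_ne_zero)
  have hquad := rogersSum_eq_sign hq hA hB (κ := ω ^ 2) (by rwa [eC])
  have hcub := rogersSum_cubic hω2 hp hA hz hβ
  have hphi := cubicSum_eq_phi hp hy (A * q ^ 2) (A ^ 3)
  rw [eC] at hquad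
  rw [eC', show A * q * A * (A * q ^ 2) = A ^ 3 * q ^ 3 by ring,
    show (A * q) ^ 3 = A ^ 3 * q ^ 3 by ring, hphi, hquad] at hcub
  rw [show A * q ^ 2 * q ^ 2 = A * q ^ 4 by ring, show A * q ^ 2 * (q ^ 2) ^ 2 = A * q ^ 6 by ring,
    show A ^ 3 * q ^ 3 * q ^ 2 = A ^ 3 * q ^ 5 by ring,
    show A ^ 3 * q ^ 3 * (q ^ 2) ^ 2 = A ^ 3 * q ^ 7 by ring, show (q ^ 2) ^ 3 = q ^ 6 by ring,
    show A * q * A = A ^ 2 * q by ring, show A * (A * q ^ 2) = A ^ 2 * q * q by ring] at hcub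
  rw [show q ^ 6 = (q ^ 2) ^ 3 by ring, ← qPochInf_cubic hω A hp,
    qPochInf_eq_even_mul_odd (A * ω ^ 2) hq, qPochInf_eq_even_mul_odd (A ^ 2 * q) hq,
    show (q ^ 2) ^ 3 = q ^ 6 by ring]
  have n1 := qPochInf_ne_zero_of_norm_lt_one hz hp
  have n2 := qPochInf_ne_zero_of_norm_lt_one hB hp
  have n3 := qPochInf_ne_zero_of_norm_lt_one (norm_mul_lt_one_of_lt_of_lt hB hq) hp
  have n4 := qPochInf_ne_zero_of_norm_lt_one hC hp
  have h5 : ‖A ^ 2 * q‖ < 1 := norm_mul_lt_one_of_lt_of_lt (norm_sq_lt_one hA) hq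
  have n5 := qPochInf_ne_zero_of_norm_lt_one h5 hp
  have n6 := qPochInf_ne_zero_of_norm_lt_one (norm_mul_lt_one_of_lt_of_lt h5 hq) hp
  generalize phi _ _ _ _ = Φ at *
  generalize ∑' n, signTerm q A (A * ω ^ 2 * q) (A * ω ^ 2) n = Γ at *
  generalize qPochInf (A * q ^ 2) (q ^ 2) = x1 at *
  generalize qPochInf (A * ω ^ 2) (q ^ 2) = x2 at *
  generalize qPochInf (A * ω ^ 2 * q) (q ^ 2) = x3 at *
  generalize qPochInf (A * ω) (q ^ 2) = x4 at *
  generalize qPochInf (A ^ 2 * q) (q ^ 2) = x5 at *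
  generalize qPochInf (A ^ 2 * q * q) (q ^ 2) = x6 at *
  generalize qPochInf A (q ^ 2) = x7 at *
  generalize qPochInf (A ^ 3 * q ^ 3) (q ^ 2) = x8 at *
  field_simp at hcub ⊢
  linear_combination hcub

theorem tsum_quadTerm_cubic (hω : IsPrimitiveRoot ω 3) (hq0 : q ≠ 0) (hq : ‖q‖ < 1)
    (hA : ‖A‖ < 1) :
    ∑' n, quadTerm q A (-(A * ω)) (A * ω) n =
      qPochInf (-A ^ 3) q * qPochInf (A ^ 3) (q ^ 3) /
        (qPochInf (A ^ 2 * ω ^ 2) (q ^ 2) * qPochInf (A ^ 4) (q ^ 2)) *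
      phi [A, A * q, A * q ^ 2] [-A ^ 3 * q, -A ^ 3 * q ^ 2] (q ^ 3) (A ^ 3) := by
  have hω1 := hω.norm_three
  have hB : ‖A * ω‖ < 1 := by rwa [norm_mul, hω1, mul_one]
  have eC : ω * (A * ω) = A * ω ^ 2 := by ring
  have hC : ‖A * ω ^ 2‖ < 1 := by rwa [norm_mul, norm_pow, hω1, one_pow, mul_one]
  have hAA := norm_sq_lt_one hA
  have hβ : ‖-A * A‖ < 1 := by
    rw [neg_mul, norm_neg]; exact norm_mul_lt_one_of_lt_of_lt hA hA
  have hy : ‖-A ^ 3‖ < 1 := by rw [norm_neg]; exact norm_pow_lt_one' hA three_ne_zero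
  have hquad := rogersSum_eq_quadratic hq0 hq hA hB (κ := ω) (by rwa [eC])
  have hcub := rogersSum_cubic hω hq hA hA hβ
  have hphi := cubicSum_eq_phi hq hy A (A ^ 3)
  rw [eC] at hquad
  rw [show -A * A * A = -A ^ 3 by ring, show (-A) ^ 3 = -A ^ 3 by ring,
    show -A * A = -A ^ 2 by ring, hphi, hquad] at hcub
  rw [← qPochInf_cubic hω A hq, show A ^ 2 * ω ^ 2 = (A * ω) ^ 2 by ring,
    show A ^ 4 = (A ^ 2) ^ 2 by ring, ← qPochInf_neg_mul (A * ω) hq, ← qPochInf_neg_mul (A ^ 2) hq]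
  have n1 := qPochInf_ne_zero_of_norm_lt_one hA hq
  have n2 := qPochInf_ne_zero_of_norm_lt_one hB hq
  have n3 := qPochInf_ne_zero_of_norm_lt_one (a := -(A * ω)) (by rwa [norm_neg]) hq
  have n4 := qPochInf_ne_zero_of_norm_lt_one hC hq
  have n5 := qPochInf_ne_zero_of_norm_lt_one hAA hq
  have n6 := qPochInf_ne_zero_of_norm_lt_one (a := -A ^ 2) (by rwa [norm_neg]) hq
  generalize phi _ _ _ _ = Φ at *
  generalize ∑' n, quadTerm q A (-(A * ω)) (A * ω) n = Γ at *
  generalize qPochInf A q = x1 at *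
  generalize qPochInf (A * ω) q = x2 at *
  generalize qPochInf (-(A * ω)) q = x3 at *
  generalize qPochInf (A * ω ^ 2) q = x4 at *
  generalize qPochInf (A ^ 2) q = x5 at *
  generalize qPochInf (-A ^ 2) q = x6 at *
  generalize qPochInf (-A ^ 3) q = x7 at *
  field_simp at hcub ⊢
  linear_combination hcub

theorem tsum_entireTerm_cubic (hω : IsPrimitiveRoot ω 3) (hq : ‖q‖ < 1) (hA : ‖A‖ < 1) :
    ∑' n, entireTerm q A (A * ω) (A * ω ^ 2) n =
      qPochInf (A ^ 3 * q) (q ^ 2) * (qPochInf (-A) q * qPochInf (A ^ 3) (q ^ 6) /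
        qPochInf (A ^ 2) q *
      phi [A, A * q ^ 2, A * q ^ 4] [A ^ 3 * q, A ^ 3 * q ^ 5] (q ^ 6) (A ^ 3)) := by
  have hp := norm_sq_lt_one hq
  have hω1 := hω.norm_three
  have hB : ‖A * ω‖ < 1 := by rwa [norm_mul, hω1, mul_one]
  have hC : ‖A * ω ^ 2‖ < 1 := by rwa [norm_mul, norm_pow, hω1, one_pow, mul_one]
  have hAA := norm_sq_lt_one hA
  have hβ := norm_mul_lt_one_of_lt_of_lt (norm_mul_lt_one_of_lt_of_lt hA hq) hA
  have hy : ‖A ^ 3 * q‖ < 1 := norm_mul_lt_one_of_lt_of_lt (norm_pow_lt_one' hA three_ne_zero) hq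
  have hphi := cubicSum_eq_phi_mul hp hy A (A ^ 3)
  rw [tsum_entireTerm_eq_rogersSum hq hA hB hC, rogersSum_cubic hω hp hA hA hβ,
    show A * q * A * A = A ^ 3 * q by ring, show (A * q) ^ 3 = A ^ 3 * q * q ^ 2 by ring, hphi,
    show q ^ 6 = (q ^ 2) ^ 3 by ring, ← qPochInf_cubic hω A hp,
    qPochInf_eq_even_mul_odd (A ^ 2) hq, show A * q * A = A ^ 2 * q by ring,
    show A * (q ^ 2) ^ 2 = A * q ^ 4 by ring,
    show A ^ 3 * q * (q ^ 2) ^ 2 = A ^ 3 * q ^ 5 by ring]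
  have n1 := qPochInf_ne_zero_of_norm_lt_one hA hp
  generalize qPochInf A (q ^ 2) = x1 at *
  field_simp

theorem tsum_entireTerm_cubic_shifted (hω : IsPrimitiveRoot ω 3) (hq : ‖q‖ < 1) (hA : ‖A‖ < 1) :
    ∑' n, entireTerm q (A * q ^ 2) (A * ω) (A * ω ^ 2) n =
      qPochInf (A ^ 3 * q ^ 3) (q ^ 2) * (qPochInf (-(A * q ^ 2)) q * qPochInf (A ^ 3) (q ^ 6) /
        ((1 - A) * (1 - A ^ 3 * q ^ 3) * qPochInf (A ^ 2 * q ^ 3) q) *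
      (phi [A * q ^ 2, A * q ^ 4, A * q ^ 6] [A ^ 3 * q ^ 5, A ^ 3 * q ^ 7] (q ^ 6) (A ^ 3) -
        A * ((1 - A * q ^ 2) / (1 - A ^ 3 * q ^ 5)) *
        phi [A * q ^ 4, A * q ^ 6, A * q ^ 8] [A ^ 3 * q ^ 7, A ^ 3 * q ^ 11] (q ^ 6)
          (A ^ 3))) := by
  have hp := norm_sq_lt_one hq
  have hω1 := hω.norm_three
  have hB : ‖A * ω‖ < 1 := by rwa [norm_mul, hω1, mul_one]
  have hC : ‖A * ω ^ 2‖ < 1 := by rwa [norm_mul, norm_pow, hω1, one_pow, mul_one]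
  have hz := norm_mul_lt_one_of_lt_of_lt hA hp
  have hz2 := norm_mul_lt_one_of_lt_of_lt hz hp
  have hβ := norm_mul_lt_one_of_lt_of_lt (norm_mul_lt_one_of_lt_of_lt hz hq) hA
  have hA3 := norm_pow_lt_one' hA three_ne_zero
  have hy : ∀ n, n ≠ 0 → ‖A ^ 3 * q ^ n‖ < 1 := fun n hn =>
    norm_mul_lt_one_of_lt_of_lt hA3 (norm_pow_lt_one' hq hn)
  have hphi1 := cubicSum_eq_phi_mul_sq hp (hy 5 (by norm_num)) (A * q ^ 2) (A ^ 3)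
  have hphi2 := cubicSum_eq_phi_mul hp (hy 7 (by norm_num)) (A * q ^ 2 * q ^ 2) (A ^ 3)
  rw [tsum_entireTerm_eq_rogersSum hq hz hB hC, rogersSum_cubic_shifted hω hp hA hβ,
    show A * q ^ 2 * q * A * (A * q ^ 2) = A ^ 3 * q ^ 5 by ring,
    show A * q ^ 2 * q * A * (A * q ^ 2 * q ^ 2) = A ^ 3 * q ^ 7 by ring,
    show (A * q ^ 2 * q) ^ 3 = A ^ 3 * q ^ 5 * (q ^ 2) ^ 2 by ring, hphi1,
    show A ^ 3 * q ^ 5 * (q ^ 2) ^ 2 = A ^ 3 * q ^ 7 * q ^ 2 by ring, hphi2,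
    show q ^ 6 = (q ^ 2) ^ 3 by ring, ← qPochInf_cubic hω A hp,
    qPochInf_eq_even_mul_odd (A ^ 2 * q ^ 3) hq, show A * q ^ 2 * q * A = A ^ 2 * q ^ 3 by ring,
    show (A * q ^ 2) ^ 2 = A ^ 2 * q ^ 3 * q by ring,
    qPochInf_eq_mul (A ^ 3 * q ^ 3) hp, show A ^ 3 * q ^ 3 * q ^ 2 = A ^ 3 * q ^ 5 by ring,
    qPochInf_eq_mul (A ^ 3 * q ^ 5) hp, show A ^ 3 * q ^ 5 * q ^ 2 = A ^ 3 * q ^ 7 by ring,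
    qPochInf_eq_mul A hp, qPochInf_eq_mul (A * q ^ 2) hp,
    show A * q ^ 2 * (q ^ 2) ^ 2 = A * q ^ 6 by ring,
    show A * q ^ 2 * q ^ 2 * (q ^ 2) ^ 2 = A * q ^ 8 by ring,
    show A * q ^ 2 * q ^ 2 * q ^ 2 = A * q ^ 6 by ring,
    show A * q ^ 2 * q ^ 2 = A * q ^ 4 by ring,
    show A ^ 3 * q ^ 7 * (q ^ 2) ^ 2 = A ^ 3 * q ^ 11 by ring,
    show (q ^ 2) ^ 3 = q ^ 6 by ring]
  have n0 := one_sub_ne_zero_of_norm_lt_one hA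
  have n1 := one_sub_ne_zero_of_norm_lt_one hz
  have n2 := one_sub_ne_zero_of_norm_lt_one (hy 3 (by norm_num))
  have n3 := one_sub_ne_zero_of_norm_lt_one (hy 5 (by norm_num))
  have n4 := qPochInf_ne_zero_of_norm_lt_one hz2 hp
  rw [show A * q ^ 2 * q ^ 2 = A * q ^ 4 by ring] at n4
  have h5 : ‖A ^ 2 * q ^ 3‖ < 1 :=
    norm_mul_lt_one_of_lt_of_lt (norm_sq_lt_one hA) (norm_pow_lt_one' hq three_ne_zero)
  have n5 := qPochInf_ne_zero_of_norm_lt_one h5 hp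
  have n6 := qPochInf_ne_zero_of_norm_lt_one (norm_mul_lt_one_of_lt_of_lt h5 hq) hp
  generalize phi [A * q ^ 2, A * q ^ 4, A * q ^ 6] _ _ _ = Φ at *
  generalize phi [A * q ^ 4, A * q ^ 6, A * q ^ 8] _ _ _ = Ψ at *
  generalize qPochInf (A * q ^ 4) (q ^ 2) = x4 at *
  generalize qPochInf (A ^ 2 * q ^ 3) (q ^ 2) = x5 at *
  generalize qPochInf (A ^ 2 * q ^ 3 * q) (q ^ 2) = x6 at *
  generalize qPochInf (A ^ 3 * q ^ 7) (q ^ 2) = x7 at *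
  generalize qPochInf (A * ω ^ 2) (q ^ 2) = x8 at *
  generalize qPochInf (A * ω) (q ^ 2) = x9 at *
  generalize 1 - A ^ 3 * q ^ 3 = y1 at *
  generalize 1 - A ^ 3 * q ^ 5 = y2 at *
  generalize 1 - A * q ^ 2 = y3 at *
  generalize 1 - A = y4 at *
  field_simp

end Core

/-! ### The four formulas: substitutions, and reduction to |A| < 1. -/

section Main

/-- (s; q)_n (-s; q)_n = (s²; q²)_n is the initial part of (s²; q²)_∞, whose tail is the infinite
product in `entireTerm`. -/
theorem tsum_entireTerm_eq_phi {q A B C s : ℂ} (hq : ‖q‖ < 1) (hs : s ^ 2 = A * B * C * q)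
    (hs1 : ‖s ^ 2‖ < 1) :
    ∑' n, entireTerm q A B C n = qPochInf (s ^ 2) (q ^ 2) * phi [B, C] [s, -s] q (-A) := by
  have hp := norm_sq_lt_one hq
  rw [phi, ← tsum_mul_left]
  refine tsum_congr fun n => ?_
  have h1 := qPoch_ne_zero hs1 hp n
  rw [phiTerm_two_two, qPoch_neg_mul, qPochInf_eq_qPoch_mul _ hp n, entireTerm, eulerTerm, ← hs,
    neg_neg]
  generalize qPoch (s ^ 2) (q ^ 2) n = x at *
  field_simp

theorem eq_of_mul_norm_pow_eq {r x : ℝ} (hr0 : 0 < r) (hr1 : r < 1) {m n : ℕ}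
    (hm : x * r ^ m = 1) (hn : x * r ^ n = 1) : m = n := by
  have hx : x ≠ 0 := by rintro rfl; simp at hm
  exact pow_right_injective₀ hr0 hr1.ne (mul_left_cancel₀ hx (hm.trans hn.symm))

variable {q a ω : ℂ}

theorem cubic_transformation_one (hq0 : 0 < ‖q‖) (hq : ‖q‖ < 1) (hω : IsPrimitiveRoot ω 3)
    (h1 : PhiConverges [a * ω, -(a * ω)] [-a ^ 2] q (a ^ 2 / q * ω ^ 2))
    (h2 : PhiConverges [a ^ 2 * q, a ^ 2 * q ^ 3, a ^ 2 * q ^ 5] [a ^ 6 * q ^ 2, a ^ 6 * q ^ 4]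
      (q ^ 6) (a ^ 6 / q ^ 3)) :
    phi [a * ω, -(a * ω)] [-a ^ 2] q (a ^ 2 / q * ω ^ 2) =
      (qPochInf (a ^ 6) (q ^ 2) * qPochInf (a ^ 6 / q ^ 3) (q ^ 6)) /
        (qPochInf (a ^ 2 / q * ω ^ 2) q * qPochInf (a ^ 4 / q) q) *
      phi [a ^ 2 * q, a ^ 2 * q ^ 3, a ^ 2 * q ^ 5] [a ^ 6 * q ^ 2, a ^ 6 * q ^ 4]
        (q ^ 6) (a ^ 6 / q ^ 3) := by
  have hq' : q ≠ 0 := norm_pos_iff.mp hq0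
  have hω1 := hω.norm_three
  obtain ⟨A, hA⟩ : ∃ A, A = a ^ 2 / q := ⟨_, rfl⟩
  have hz2 : a ^ 6 / q ^ 3 = A ^ 3 := by rw [hA]; field_simp
  -- Otherwise both series terminate; the left one makes |a|² an even power of 1/|q|, the right one
  -- an odd power.
  have hA1 : ‖A‖ < 1 := by
    by_contra! hge
    obtain ⟨x, hx, n, hn⟩ := exists_mul_pow_eq_one_of_phiConverges hq rfl
      (by rwa [← hA, norm_mul, norm_pow, hω1, one_pow, mul_one]) h1
    obtain ⟨y, hy, m, hm⟩ := exists_mul_pow_eq_one_of_phiConverges (norm_pow_lt_one' hq (by simp))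
      rfl (by rw [hz2, norm_pow]; exact one_le_pow₀ hge) h2
    have e1 : ‖a‖ ^ 2 * ‖q‖ ^ (2 * n) = 1 := by
      have hx' : ‖x‖ = ‖a‖ := by
        simp only [List.mem_cons, List.not_mem_nil, or_false] at hx
        rcases hx with rfl | rfl <;> simp [hω1]
      rw [← hx', pow_mul', ← mul_pow, ← norm_pow q, ← norm_mul, hn]
      simp
    have e2 : ∃ j, ‖a‖ ^ 2 * ‖q‖ ^ (2 * j + 1) = 1 := by
      have hn := congrArg norm hm
      rw [norm_one] at hn
      simp only [List.mem_cons, List.not_mem_nil, or_false] at hy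
      rcases hy with rfl | rfl | rfl
      · refine ⟨3 * m, Eq.trans ?_ hn⟩
        rw [← norm_pow, ← norm_pow, ← norm_mul]; congr 1; ring
      · refine ⟨3 * m + 1, Eq.trans ?_ hn⟩
        rw [← norm_pow, ← norm_pow, ← norm_mul]; congr 1; ring
      · refine ⟨3 * m + 2, Eq.trans ?_ hn⟩
        rw [← norm_pow, ← norm_pow, ← norm_mul]; congr 1; ring
    obtain ⟨j, hj⟩ := e2
    have := eq_of_mul_norm_pow_eq hq0 hq e1 hj
    omega
  have ha : a ^ 2 = A * q := by rw [hA]; field_simp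
  have ha6 : a ^ 6 = A ^ 3 * q ^ 3 := by linear_combination (a ^ 4 + a ^ 2 * A * q + A ^ 2 * q ^ 2) * ha
  have ha4 : a ^ 4 / q = A ^ 2 * q := by
    rw [show a ^ 4 = (a ^ 2) ^ 2 by ring, ha]; field_simp
  have hL : phi [a * ω, -(a * ω)] [-a ^ 2] q (A * ω ^ 2) =
      ∑' n, signTerm q A (A * ω ^ 2 * q) (A * ω ^ 2) n := by
    refine tsum_congr fun n => ?_
    rw [phiTerm_two_one, qPoch_neg_mul, signTerm, ha, mul_pow, ha,
      show A * q * ω ^ 2 = A * ω ^ 2 * q by ring]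
  rw [hz2, ← hA, hL, ha4, ha6, ha, tsum_signTerm_cubic hω hq hA1]
  congr 2 <;> ring_nf

theorem cubic_transformation_two (hq0 : 0 < ‖q‖) (hq : ‖q‖ < 1) (hω : IsPrimitiveRoot ω 3)
    (h1 : PhiConverges [a * ω, a * q * ω] [a ^ 2 * q] (q ^ 2) (a ^ 2 * ω ^ 2))
    (h2 : PhiConverges [-a, -(a * q), -(a * q ^ 2)] [a ^ 3 * q, a ^ 3 * q ^ 2] (q ^ 3) (-a ^ 3)) :
    phi [a * ω, a * q * ω] [a ^ 2 * q] (q ^ 2) (a ^ 2 * ω ^ 2) =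
      (qPochInf (a ^ 3) q * qPochInf (-a ^ 3) (q ^ 3)) /
        (qPochInf (a ^ 2 * ω ^ 2) (q ^ 2) * qPochInf (a ^ 4) (q ^ 2)) *
      phi [-a, -(a * q), -(a * q ^ 2)] [a ^ 3 * q, a ^ 3 * q ^ 2] (q ^ 3) (-a ^ 3) := by
  have hq' : q ≠ 0 := norm_pos_iff.mp hq0
  have hω1 := hω.norm_three
  -- Otherwise both series terminate, with aωq^i = 1 = -aq^j. Comparing moduli gives i = j, hence ω
  -- = -1, which is not a cube root of unity.
  have hA1 : ‖a‖ < 1 := by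
    by_contra! hge
    obtain ⟨x, hx, n, hn⟩ := exists_mul_pow_eq_one_of_phiConverges (norm_sq_lt_one hq) rfl
      (by rw [norm_mul, norm_pow, norm_pow, hω1, one_pow, mul_one]; exact one_le_pow₀ hge) h1
    obtain ⟨y, hy, m, hm⟩ := exists_mul_pow_eq_one_of_phiConverges (norm_pow_lt_one' hq (by simp))
      rfl (by rw [norm_neg, norm_pow]; exact one_le_pow₀ hge) h2
    have e1 : ∃ j, a * ω * q ^ j = 1 := by
      simp only [List.mem_cons, List.not_mem_nil, or_false] at hx
      rcases hx with rfl | rfl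
      · exact ⟨2 * n, by rw [← hn]; ring⟩
      · exact ⟨2 * n + 1, by rw [← hn]; ring⟩
    have e2 : ∃ j, -a * q ^ j = 1 := by
      simp only [List.mem_cons, List.not_mem_nil, or_false] at hy
      rcases hy with rfl | rfl | rfl
      · exact ⟨3 * m, by rw [← hm]; ring⟩
      · exact ⟨3 * m + 1, by rw [← hm]; ring⟩
      · exact ⟨3 * m + 2, by rw [← hm]; ring⟩
    obtain ⟨i, hi⟩ := e1
    obtain ⟨j, hj⟩ := e2
    have ni := congrArg norm hi
    have nj := congrArg norm hj
    simp only [norm_mul, norm_neg, norm_pow, norm_one, hω1, mul_one] at ni nj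
    have hij := eq_of_mul_norm_pow_eq hq0 hq ni nj
    subst hij
    have hω3 : ω = -1 := by linear_combination -ω * hj - hi
    have h3 := hω.pow_eq_one
    rw [hω3] at h3
    norm_num at h3
  have hA : ‖-a‖ < 1 := by rwa [norm_neg]
  -- The core identity is used at A = -a.
  have hL : phi [a * ω, a * q * ω] [a ^ 2 * q] (q ^ 2) (a ^ 2 * ω ^ 2) =
      ∑' n, quadTerm q (-a) (-(-a * ω)) (-a * ω) n := by
    refine tsum_congr fun n => ?_
    rw [phiTerm_two_one, quadTerm, qPoch_two_mul, neg_mul, neg_neg, neg_sq, neg_sq,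
      mul_right_comm a q ω, show a ^ 2 * ω ^ 2 = (a * ω) ^ 2 by ring]
  rw [hL, tsum_quadTerm_cubic hω hq' hq hA]
  congr 2 <;> ring_nf

theorem cubic_transformation_three (hq0 : 0 < ‖q‖) (hq : ‖q‖ < 1) (hω : IsPrimitiveRoot ω 3)
    (h2 : PhiConverges [a ^ 2 / q, a ^ 2 * q, a ^ 2 * q ^ 3] [a ^ 6 / q ^ 2, a ^ 6 * q ^ 2]
      (q ^ 6) (a ^ 6 / q ^ 3))
    (h3 : qPochInf (a ^ 4 / q ^ 2) q ≠ 0) :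
    phi [a ^ 2 / q * ω, a ^ 2 / q * ω ^ 2] [a ^ 3 / q, -(a ^ 3 / q)] q (-(a ^ 2 / q)) =
      (qPochInf (-(a ^ 2 / q)) q * qPochInf (a ^ 6 / q ^ 3) (q ^ 6)) /
        qPochInf (a ^ 4 / q ^ 2) q *
      phi [a ^ 2 / q, a ^ 2 * q, a ^ 2 * q ^ 3] [a ^ 6 / q ^ 2, a ^ 6 * q ^ 2]
        (q ^ 6) (a ^ 6 / q ^ 3) := by
  have hq' : q ≠ 0 := norm_pos_iff.mp hq0
  obtain ⟨A, hA⟩ : ∃ A, A = a ^ 2 / q := ⟨_, rfl⟩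
  have ha : a ^ 2 = A * q := by rw [hA]; field_simp
  have hz2 : a ^ 6 / q ^ 3 = A ^ 3 := by rw [hA]; field_simp
  have ha4 : a ^ 4 / q ^ 2 = A ^ 2 := by rw [hA]; field_simp
  have ha6 : a ^ 6 = A ^ 3 * q ^ 3 := by
    linear_combination (a ^ 4 + a ^ 2 * A * q + A ^ 2 * q ^ 2) * ha
  have ha62 : a ^ 6 / q ^ 2 = A ^ 3 * q := by rw [ha6]; field_simp
  have hs : (a ^ 3 / q) ^ 2 = A ^ 3 * q := by rw [← ha62]; ring
  have e6 : a ^ 6 * q ^ 2 = A ^ 3 * q ^ 5 := by rw [ha6]; ring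
  have e1 : a ^ 2 * q = A * q ^ 2 := by rw [ha]; ring
  have e3 : a ^ 2 * q ^ 3 = A * q ^ 4 := by rw [ha]; ring
  rw [hz2, ha62, ← hA, e1, e3] at h2
  rw [ha4] at h3
  rw [hz2, ha62, ha4, e6, e3, e1, ← hA]
  -- Otherwise Aq^j = 1 for some j, so A²q^(2j) = 1 and (A²; q)_∞, which is assumed nonzero,
  -- vanishes.
  have hA1 : ‖A‖ < 1 := by
    by_contra! hge
    obtain ⟨x, hx, n, hn⟩ := exists_mul_pow_eq_one_of_phiConverges (norm_pow_lt_one' hq (by simp))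
      rfl (by rw [norm_pow]; exact one_le_pow₀ hge) h2
    have e : ∃ j, A * q ^ j = 1 := by
      simp only [List.mem_cons, List.not_mem_nil, or_false] at hx
      rcases hx with rfl | rfl | rfl
      · exact ⟨6 * n, by rw [← hn]; ring⟩
      · exact ⟨6 * n + 2, by rw [← hn]; ring⟩
      · exact ⟨6 * n + 4, by rw [← hn]; ring⟩
    obtain ⟨j, hj⟩ := e
    refine h3 (qPochInf_eq_zero hq (n := 2 * j) ?_)
    linear_combination (A * q ^ j + 1) * hj
  have hy : ‖A ^ 3 * q‖ < 1 :=
    norm_mul_lt_one_of_lt_of_lt (norm_pow_lt_one' hA1 three_ne_zero) hq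
  have hent := tsum_entireTerm_cubic hω hq hA1
  rw [tsum_entireTerm_eq_phi hq (s := a ^ 3 / q)
    (by rw [hs]; linear_combination (-A ^ 3 * q) * hω.pow_eq_one) (by rwa [hs]), hs] at hent
  exact mul_left_cancel₀ (qPochInf_ne_zero_of_norm_lt_one hy (norm_sq_lt_one hq)) hent

theorem cubic_transformation_four (hq0 : 0 < ‖q‖) (hq : ‖q‖ < 1) (hω : IsPrimitiveRoot ω 3)
    (h2 : PhiConverges [a ^ 2 / q, a ^ 2 * q, a ^ 2 * q ^ 3] [a ^ 6 / q ^ 4, a ^ 6 / q ^ 2]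
      (q ^ 6) (a ^ 6 / q ^ 9))
    (h3 : qPochInf (a ^ 4 / q ^ 3) q ≠ 0) :
    phi [a ^ 2 / q ^ 3 * ω, a ^ 2 / q ^ 3 * ω ^ 2] [a ^ 3 / q ^ 3, -(a ^ 3 / q ^ 3)]
        q (-(a ^ 2 / q)) =
      (qPochInf (-(a ^ 2 / q)) q * qPochInf (a ^ 6 / q ^ 9) (q ^ 6)) /
        ((1 - a ^ 2 / q ^ 3) * (1 - a ^ 6 / q ^ 6) * qPochInf (a ^ 4 / q ^ 3) q) *
      (phi [a ^ 2 / q, a ^ 2 * q, a ^ 2 * q ^ 3] [a ^ 6 / q ^ 4, a ^ 6 / q ^ 2]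
          (q ^ 6) (a ^ 6 / q ^ 9) -
        a ^ 2 / q ^ 3 * ((1 - a ^ 2 / q) / (1 - a ^ 6 / q ^ 4)) *
        phi [a ^ 2 * q, a ^ 2 * q ^ 3, a ^ 2 * q ^ 5] [a ^ 6 / q ^ 2, a ^ 6 * q ^ 2]
          (q ^ 6) (a ^ 6 / q ^ 9)) := by
  have hq' : q ≠ 0 := norm_pos_iff.mp hq0
  obtain ⟨A, hA⟩ : ∃ A, A = a ^ 2 / q ^ 3 := ⟨_, rfl⟩
  have ha : a ^ 2 = A * q ^ 3 := by rw [hA]; field_simp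
  have ha1 : a ^ 2 / q = A * q ^ 2 := by rw [ha]; field_simp
  have ha4 : a ^ 4 / q ^ 3 = A ^ 2 * q ^ 3 := by
    rw [show a ^ 4 = (a ^ 2) ^ 2 by ring, ha]; field_simp
  have ha6 : a ^ 6 = A ^ 3 * q ^ 9 := by
    linear_combination (a ^ 4 + a ^ 2 * A * q ^ 3 + A ^ 2 * q ^ 6) * ha
  have ha62 : a ^ 6 / q ^ 2 = A ^ 3 * q ^ 7 := by rw [ha6]; field_simp
  have ha64 : a ^ 6 / q ^ 4 = A ^ 3 * q ^ 5 := by rw [ha6]; field_simp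
  have ha66 : a ^ 6 / q ^ 6 = A ^ 3 * q ^ 3 := by rw [ha6]; field_simp
  have ha69 : a ^ 6 / q ^ 9 = A ^ 3 := by rw [ha6]; field_simp
  have hs : (a ^ 3 / q ^ 3) ^ 2 = A ^ 3 * q ^ 3 := by rw [← ha66]; ring
  have e6 : a ^ 6 * q ^ 2 = A ^ 3 * q ^ 11 := by rw [ha6]; ring
  have e1 : a ^ 2 * q = A * q ^ 4 := by rw [ha]; ring
  have e3 : a ^ 2 * q ^ 3 = A * q ^ 6 := by rw [ha]; ring
  have e5 : a ^ 2 * q ^ 5 = A * q ^ 8 := by rw [ha]; ring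
  rw [ha62, ha64, ha69, ha1, e1, e3] at h2
  rw [ha4] at h3
  -- Otherwise a numerator parameter gives Aq^(j+2) = 1. Squaring gives A²q³ · q^(2j+1) = 1, a zero
  -- of (A²q³; q)_∞; the exponent is available because the parameters start at Aq², not at A.
  have hA1 : ‖A‖ < 1 := by
    by_contra! hge
    obtain ⟨x, hx, n, hn⟩ := exists_mul_pow_eq_one_of_phiConverges (norm_pow_lt_one' hq (by simp))
      rfl (by rw [norm_pow]; exact one_le_pow₀ hge) h2
    have e : ∃ j, A * q ^ (j + 2) = 1 := by
      simp only [List.mem_cons, List.not_mem_nil, or_false] at hx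
      rcases hx with rfl | rfl | rfl
      · exact ⟨6 * n, by rw [← hn]; ring⟩
      · exact ⟨6 * n + 2, by rw [← hn]; ring⟩
      · exact ⟨6 * n + 4, by rw [← hn]; ring⟩
    obtain ⟨j, hj⟩ := e
    refine h3 (qPochInf_eq_zero hq (n := 2 * j + 1) ?_)
    linear_combination (A * q ^ (j + 2) + 1) * hj
  have hy : ‖A ^ 3 * q ^ 3‖ < 1 := norm_mul_lt_one_of_lt_of_lt
    (norm_pow_lt_one' hA1 three_ne_zero) (norm_pow_lt_one' hq three_ne_zero)
  have hent := tsum_entireTerm_cubic_shifted hω hq hA1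
  rw [tsum_entireTerm_eq_phi hq (s := a ^ 3 / q ^ 3)
    (by rw [hs]; linear_combination (-A ^ 3 * q ^ 3) * hω.pow_eq_one) (by rwa [hs]), hs] at hent
  rw [ha62, ha64, ha66, ha69, ha1, ha4, e6, e5, e3, e1, ← hA]
  exact mul_left_cancel₀ (qPochInf_ne_zero_of_norm_lt_one hy (norm_sq_lt_one hq)) hent

end Main

theorem mainTheorem6 (q a ω : ℂ) (hq0 : 0 < ‖q‖) (hq1 : ‖q‖ < 1) (hω : IsPrimitiveRoot ω 3) :
    (PhiConverges [a * ω, -(a * ω)] [-a ^ 2] q (a ^ 2 / q * ω ^ 2) →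
      PhiConverges [a ^ 2 * q, a ^ 2 * q ^ 3, a ^ 2 * q ^ 5] [a ^ 6 * q ^ 2, a ^ 6 * q ^ 4]
        (q ^ 6) (a ^ 6 / q ^ 3) →
      phi [a * ω, -(a * ω)] [-a ^ 2] q (a ^ 2 / q * ω ^ 2) =
        (qPochInf (a ^ 6) (q ^ 2) * qPochInf (a ^ 6 / q ^ 3) (q ^ 6)) /
          (qPochInf (a ^ 2 / q * ω ^ 2) q * qPochInf (a ^ 4 / q) q) *
        phi [a ^ 2 * q, a ^ 2 * q ^ 3, a ^ 2 * q ^ 5] [a ^ 6 * q ^ 2, a ^ 6 * q ^ 4]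
          (q ^ 6) (a ^ 6 / q ^ 3)) ∧
    (PhiConverges [a * ω, a * q * ω] [a ^ 2 * q] (q ^ 2) (a ^ 2 * ω ^ 2) →
      PhiConverges [-a, -(a * q), -(a * q ^ 2)] [a ^ 3 * q, a ^ 3 * q ^ 2] (q ^ 3) (-a ^ 3) →
      phi [a * ω, a * q * ω] [a ^ 2 * q] (q ^ 2) (a ^ 2 * ω ^ 2) =
        (qPochInf (a ^ 3) q * qPochInf (-a ^ 3) (q ^ 3)) /
          (qPochInf (a ^ 2 * ω ^ 2) (q ^ 2) * qPochInf (a ^ 4) (q ^ 2)) *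
        phi [-a, -(a * q), -(a * q ^ 2)] [a ^ 3 * q, a ^ 3 * q ^ 2] (q ^ 3) (-a ^ 3)) ∧
    (PhiConverges [a ^ 2 / q * ω, a ^ 2 / q * ω ^ 2] [a ^ 3 / q, -(a ^ 3 / q)] q (-(a ^ 2 / q)) →
      PhiConverges [a ^ 2 / q, a ^ 2 * q, a ^ 2 * q ^ 3] [a ^ 6 / q ^ 2, a ^ 6 * q ^ 2]
        (q ^ 6) (a ^ 6 / q ^ 3) →
      qPochInf (a ^ 4 / q ^ 2) q ≠ 0 →
      phi [a ^ 2 / q * ω, a ^ 2 / q * ω ^ 2] [a ^ 3 / q, -(a ^ 3 / q)] q (-(a ^ 2 / q)) =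
        (qPochInf (-(a ^ 2 / q)) q * qPochInf (a ^ 6 / q ^ 3) (q ^ 6)) /
          qPochInf (a ^ 4 / q ^ 2) q *
        phi [a ^ 2 / q, a ^ 2 * q, a ^ 2 * q ^ 3] [a ^ 6 / q ^ 2, a ^ 6 * q ^ 2]
          (q ^ 6) (a ^ 6 / q ^ 3)) ∧
    (PhiConverges [a ^ 2 / q ^ 3 * ω, a ^ 2 / q ^ 3 * ω ^ 2] [a ^ 3 / q ^ 3, -(a ^ 3 / q ^ 3)]
        q (-(a ^ 2 / q)) →
      PhiConverges [a ^ 2 / q, a ^ 2 * q, a ^ 2 * q ^ 3] [a ^ 6 / q ^ 4, a ^ 6 / q ^ 2]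
        (q ^ 6) (a ^ 6 / q ^ 9) →
      PhiConverges [a ^ 2 * q, a ^ 2 * q ^ 3, a ^ 2 * q ^ 5] [a ^ 6 / q ^ 2, a ^ 6 * q ^ 2]
        (q ^ 6) (a ^ 6 / q ^ 9) →
      qPochInf (a ^ 4 / q ^ 3) q ≠ 0 →
      phi [a ^ 2 / q ^ 3 * ω, a ^ 2 / q ^ 3 * ω ^ 2] [a ^ 3 / q ^ 3, -(a ^ 3 / q ^ 3)]
          q (-(a ^ 2 / q)) =
        (qPochInf (-(a ^ 2 / q)) q * qPochInf (a ^ 6 / q ^ 9) (q ^ 6)) /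
          ((1 - a ^ 2 / q ^ 3) * (1 - a ^ 6 / q ^ 6) * qPochInf (a ^ 4 / q ^ 3) q) *
        (phi [a ^ 2 / q, a ^ 2 * q, a ^ 2 * q ^ 3] [a ^ 6 / q ^ 4, a ^ 6 / q ^ 2]
            (q ^ 6) (a ^ 6 / q ^ 9) -
          a ^ 2 / q ^ 3 * ((1 - a ^ 2 / q) / (1 - a ^ 6 / q ^ 4)) *
          phi [a ^ 2 * q, a ^ 2 * q ^ 3, a ^ 2 * q ^ 5] [a ^ 6 / q ^ 2, a ^ 6 * q ^ 2]
            (q ^ 6) (a ^ 6 / q ^ 9))) := by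
  refine ⟨fun h1 h2 => ?_, fun h1 h2 => ?_, fun _ h2 h3 => ?_, fun _ h2 _ h3 => ?_⟩
  · exact cubic_transformation_one hq0 hq1 hω h1 h2
  · exact cubic_transformation_two hq0 hq1 hω h1 h2
  · exact cubic_transformation_three hq0 hq1 hω h2 h3
  · exact cubic_transformation_four hq0 hq1 hω h2 h3
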